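/- Let $I$ be a Polish space, let $0\le\alpha<1$ and $\theta>-\alpha$, and let $H$ be a non-atomic Borel probability measure on $I$. For $\theta'>-\alpha$ let $\Pi_{\alpha,\theta'}$ be the law, on the space $\mathcal P_I$ of Borel probability measures on $I$ with the topology of weak convergence, of the two-parameter Poisson–Dirichlet process $$P_{\alpha,\theta'}=\sum_{k=1}^\infty V_k\prod_{j=1}^{k-1}(1-V_j)\,\delta_{Z_k},$$ where the $V_k\sim\mathrm{beta}(1-\alpha,\theta'+k\alpha)$ and the $Z_k\sim H$ are all independent. For data $X_1,\dots,X_n$ ($n\ge 1$) with distinct values $Y_1,\dots,Y_k$, $Y_j$ occurring $e_j$ times, the posterior distribution $\Pi^{(n)}_{\alpha,\theta}$ under the prior $\Pi_{\alpha,\theta}$ is (in the version given by Pitman) the law on $\mathcal P_I$ of $$R\,P_{\alpha,\theta+k\alpha}+(1-R)\sum_{j=1}^{k}\Delta_j\,\delta_{Y_j},$$ where, given the data, $R\sim\mathrm{beta}(\theta+k\alpha,\,n-k\alpha)$, $P_{\alpha,\theta+k\alpha}\sim\Pi_{\alpha,\theta+k\alpha}$ and $(\Delta_1,\dots,\Delta_k)\sim\mathrm{Dirichlet}(e_1-\alpha,\dots,e_k-\alpha)$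 are independent. **Proposition 2.1.** Let $P_0$ be a non-atomic Borel probability measure on $I$. Then, for $P_0^\infty$-almost every data sequence $(X_1,X_2,\dots)$, the posterior distributions $\Pi^{(n)}_{\alpha,\theta}$ converge weakly, as $n\to\infty$, to the point mass at $\alpha H+(1-\alpha)P_0$. Hence the posterior is consistent at $P_0$ (that is, for $P_0^\infty$-almost every data sequence it converges weakly to the point mass at $P_0$) if and only if $\alpha=0$ (the Dirichlet process case) or $H=P_0$. -/

import Mathlib

open MeasureTheory ProbabilityTheory Filter Topology

namespace PoissonDirichlet

section WeakBorel

/-! The space of probability measures on `I` carries in Mathlib the topology of weak convergence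
and the σ-algebra generated by the evaluations `P ↦ P A`.  On a Polish space the latter is the
Borel σ-algebra of the former, so that weak convergence of laws on that space makes sense. -/

variable {I : Type*} [TopologicalSpace I] [PolishSpace I] [MeasurableSpace I] [BorelSpace I]

theorem isOpen_setOf_lt_measure {G : Set I} (hG : IsOpen G) (r : ENNReal) :
    IsOpen {P : ProbabilityMeasure I | r < (P : Measure I) G} := by
  let _ := TopologicalSpace.upgradeIsCompletelyMetrizable I
  rw [isOpen_iff_mem_nhds]
  intro P hP
  have h := ProbabilityMeasure.le_liminf_measure_open_of_tendsto (L := 𝓝 P)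
    (μs := fun Q : ProbabilityMeasure I => Q) (μ := P) tendsto_id hG
  exact eventually_lt_of_lt_liminf (lt_of_lt_of_le hP h)

theorem continuous_of_isOpen_setOf_lt {X : Type*} [TopologicalSpace X]
    [FirstCountableTopology X] (f : X → ProbabilityMeasure I)
    (h : ∀ G : Set I, IsOpen G → ∀ r : ENNReal, IsOpen {x | r < (f x : Measure I) G}) :
    Continuous f := by
  let _ := TopologicalSpace.upgradeIsCompletelyMetrizable I
  rw [continuous_iff_continuousAt]
  intro x
  refine tendsto_of_forall_isOpen_le_liminf' fun G hG => ?_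
  refine le_of_forall_lt fun r hr => ?_
  obtain ⟨q, hrq, hq⟩ := exists_between hr
  refine lt_of_lt_of_le hrq (le_liminf_of_le (by isBoundedDefault) ?_)
  filter_upwards [(h G hG q).mem_nhds hq] with y hy using le_of_lt hy

theorem exists_countable_subbasis :
    ∃ S : Set (Set (ProbabilityMeasure I)), S.Countable ∧
      (∀ s ∈ S, MeasurableSet s) ∧
      (inferInstance : TopologicalSpace (ProbabilityMeasure I)) =
        TopologicalSpace.generateFrom S := by
  let B := TopologicalSpace.countableBasis I
  have hBc : B.Countable := TopologicalSpace.countable_countableBasis I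
  have hB : TopologicalSpace.IsTopologicalBasis B :=
    TopologicalSpace.isBasis_countableBasis I
  let F : Set (Set (Set I)) := {s | s.Finite ∧ s ⊆ B}
  have hF : F.Countable := Set.countable_ofPred_finite_subset hBc
  obtain ⟨D, hDc, hD⟩ := TopologicalSpace.exists_countable_dense ENNReal
  let T : Set (Set I × ENNReal) := (Set.sUnion '' F) ×ˢ D
  have hT : T.Countable := (hF.image _).prod hDc
  let f : Set I × ENNReal → Set (ProbabilityMeasure I) :=
    fun p => {P | p.2 < (P : Measure I) p.1}
  have hopen : ∀ G ∈ Set.sUnion '' F, IsOpen G := by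
    rintro _ ⟨s, hs, rfl⟩
    exact isOpen_sUnion fun t ht => hB.isOpen (hs.2 ht)
  refine ⟨f '' T, hT.image f, ?_, ?_⟩
  · rintro _ ⟨p, hp, rfl⟩
    exact measurableSet_lt measurable_const
      ((Measure.measurable_coe (hopen p.1 hp.1).measurableSet).comp measurable_subtype_coe)
  · apply le_antisymm
    · apply le_generateFrom
      rintro _ ⟨p, hp, rfl⟩
      exact isOpen_setOf_lt_measure (hopen p.1 hp.1) _
    · rw [← continuous_id_iff_le]
      refine @continuous_of_isOpen_setOf_lt I _ _ _ _ _ (TopologicalSpace.generateFrom (f '' T))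
        (@TopologicalSpace.SecondCountableTopology.to_firstCountableTopology _
          (TopologicalSpace.generateFrom (f '' T))
          (@SecondCountableTopology.mk _ (TopologicalSpace.generateFrom (f '' T))
            ⟨_, hT.image f, rfl⟩)) id fun G hG r => ?_
      have key : {P : ProbabilityMeasure I | r < ((id P : ProbabilityMeasure I) : Measure I) G} =
          ⋃₀ {s | s ∈ f '' T ∧ s ⊆ {P : ProbabilityMeasure I | r < (P : Measure I) G}} := by
        apply Set.Subset.antisymm
        · intro P hP
          change r < (P : Measure I) G at hP
          obtain ⟨S, hSB, rfl⟩ := hB.open_eq_sUnion hG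
          have hSc : S.Countable := hBc.mono hSB
          obtain ⟨q, hqD, hrq, hq⟩ := hD.exists_between hP
          have hs : ∃ s : Set (Set I), s.Finite ∧ s ⊆ S ∧ q < (P : Measure I) (⋃₀ s) := by
            have hdir : DirectedOn (fun a b : Set (Set I) => ⋃₀ a ⊆ ⋃₀ b)
                {s | s.Finite ∧ s ⊆ S} := fun a ha b hb =>
              ⟨a ∪ b, ⟨ha.1.union hb.1, Set.union_subset ha.2 hb.2⟩,
                Set.sUnion_subset_sUnion Set.subset_union_left,
                Set.sUnion_subset_sUnion Set.subset_union_right⟩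
            have hU : ⋃₀ S = ⋃ s ∈ {s : Set (Set I) | s.Finite ∧ s ⊆ S}, ⋃₀ s := by
              apply Set.Subset.antisymm
              · rintro z ⟨t, ht, hz⟩
                exact Set.mem_biUnion (x := {t})
                  ⟨Set.finite_singleton t, Set.singleton_subset_iff.2 ht⟩ ⟨t, rfl, hz⟩
              · exact Set.iUnion₂_subset fun s hs => Set.sUnion_subset_sUnion hs.2
            rw [hU, measure_biUnion_eq_iSup (Set.countable_ofPred_finite_subset hSc) hdir] at hq
            simp only [lt_iSup_iff] at hq
            obtain ⟨s, hs, hqs⟩ := hq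
            exact ⟨s, hs.1, hs.2, hqs⟩
          obtain ⟨s, hsf, hsS, hqs⟩ := hs
          refine ⟨f (⋃₀ s, q), ⟨⟨_, ⟨⟨s, ⟨hsf, hsS.trans hSB⟩, rfl⟩, hqD⟩, rfl⟩, ?_⟩, hqs⟩
          intro Q hQ
          exact hrq.trans (lt_of_lt_of_le hQ (measure_mono (Set.sUnion_subset_sUnion hsS)))
        · rintro P ⟨s, hs, hPs⟩
          exact hs.2 hPs
      rw [key]
      exact @isOpen_sUnion _ (TopologicalSpace.generateFrom (f '' T)) _
        fun s hs => TopologicalSpace.isOpen_generateFrom_of_mem hs.1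

instance secondCountable_weak : SecondCountableTopology (ProbabilityMeasure I) := by
  obtain ⟨S, hS, -, h⟩ := exists_countable_subbasis (I := I)
  exact ⟨S, hS, h⟩

instance borelSpace_weak : BorelSpace (ProbabilityMeasure I) := by
  constructor
  apply le_antisymm
  · let _ : MeasurableSpace (ProbabilityMeasure I) := borel _
    have hb : BorelSpace (ProbabilityMeasure I) := ⟨rfl⟩
    have hm : Measurable (fun P : ProbabilityMeasure I => (P : Measure I)) := by
      refine Measurable.measure_of_isPiSystem_of_isProbabilityMeasure
        (S := {s : Set I | IsOpen s}) (BorelSpace.measurable_eq (α := I))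
        isPiSystem_isOpen fun s hs => ?_
      exact measurable_of_Ioi fun r => (isOpen_setOf_lt_measure hs r).measurableSet
    exact measurable_iff_comap_le.1 hm
  · obtain ⟨S, hS, hm, h⟩ := exists_countable_subbasis (I := I)
    rw [borel_eq_generateFrom_of_subbasis h]
    exact MeasurableSpace.generateFrom_le hm

end WeakBorel

/-! ### Beta and Dirichlet distributions -/

/-- The beta(`a`, `b`) law, for `a, b > 0`; outside this range the point mass at `1`
(in agreement with the convention beta(`a`, `0`) `= δ₁`). -/
noncomputable def betaLaw (a b : ℝ) : ProbabilityMeasure ℝ :=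
  open Classical in
  if h : 0 < a ∧ 0 < b then ⟨betaMeasure a b, isProbabilityMeasureBeta h.1 h.2⟩ else diracProba 1

/-- The gamma law with shape `a > 0` and rate `1`; the point mass at `0` for `a ≤ 0`. -/
noncomputable def gammaLaw (a : ℝ) : ProbabilityMeasure ℝ :=
  open Classical in
  if h : 0 < a then ⟨gammaMeasure a 1, isProbabilityMeasure_gammaMeasure h one_pos⟩
  else diracProba 0

/-- The Dirichlet law with parameters `a i > 0`, `i ∈ ι`: the law of the vector
`(G i / ∑ j, G j)_i` for independent gamma(`a i`) variables `G i`. -/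
noncomputable def dirichletLaw {ι : Type*} [Fintype ι] (a : ι → ℝ) :
    ProbabilityMeasure (ι → ℝ) :=
  (ProbabilityMeasure.pi fun i => gammaLaw (a i)).map
    (f := fun g i => g i / ∑ j, g j) (by fun_prop)

/-! ### Random probability measures -/

section RandomMeasures

variable {I : Type*} [MeasurableSpace I]

/-- A measure of total mass one, regarded as an element of the space of probability measures.
The random measures below have total mass one almost surely; on the exceptional null set the
fixed value `Q` is used. -/
noncomputable def toProb (Q : ProbabilityMeasure I) (μ : Measure I) : ProbabilityMeasure I :=
  open Classical in
  if h : IsProbabilityMeasure μ then ⟨μ, h⟩ else Q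

theorem measurable_toProb (Q : ProbabilityMeasure I) : Measurable (toProb Q) := by
  classical
  refine Measurable.dite (f := fun μ : {μ : Measure I | IsProbabilityMeasure μ} =>
    (⟨μ.1, μ.2⟩ : ProbabilityMeasure I)) (g := fun _ => Q)
    (Measurable.subtype_mk measurable_subtype_coe) measurable_const
    ProbabilityMeasure.measurableSet_isProbabilityMeasure

/-- The discrete measure `∑ k, V k * ∏ j < k, (1 - V j) δ_{Z k}`. -/
noncomputable def stickBreaking (p : (ℕ → ℝ) × (ℕ → I)) : Measure I :=
  Measure.sum fun k =>
    ENNReal.ofReal (p.1 k * ∏ j ∈ Finset.range k, (1 - p.1 j)) • Measure.dirac (p.2 k)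

theorem measurable_stickBreaking : Measurable (stickBreaking (I := I)) := by
  refine Measure.measurable_of_measurable_coe _ fun s hs => ?_
  simp only [stickBreaking, Measure.sum_apply _ hs, Measure.smul_apply, smul_eq_mul]
  refine Measurable.tsum fun k => Measurable.mul (by fun_prop) ?_
  exact (Measure.measurable_coe hs).comp (Measure.measurable_dirac.comp (by fun_prop))

/-- The law on `(ℕ → ℝ) × (ℕ → I)` of the sticks and atoms `((V k)_k, (Z k)_k)`: all variables
are independent, `V k` is beta(`1 - α`, `θ + (k + 1) α`) for `k = 0, 1, 2, …`, and every `Z k`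
has law `H`. -/
noncomputable def sticksAndAtoms (α θ : ℝ) (H : ProbabilityMeasure I) :
    ProbabilityMeasure ((ℕ → ℝ) × (ℕ → I)) :=
  ProbabilityMeasure.prod
    ⟨Measure.infinitePi fun k : ℕ => (betaLaw (1 - α) (θ + (k + 1) * α) : Measure ℝ),
      inferInstance⟩
    ⟨Measure.infinitePi fun _ : ℕ => (H : Measure I), inferInstance⟩

/-- The two-parameter `(α, θ)` Poisson–Dirichlet process with base distribution `H`, as a law on
the space of probability measures on `I`. -/
noncomputable def poissonDirichlet (α θ : ℝ) (H : ProbabilityMeasure I) :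
    ProbabilityMeasure (ProbabilityMeasure I) :=
  (sticksAndAtoms α θ H).map (f := fun p => toProb H (stickBreaking p))
    ((measurable_toProb H).comp measurable_stickBreaking).aemeasurable

/-! ### The posterior -/

/-- The set of distinct values among the data `x 0, …, x (n - 1)`. -/
noncomputable def distinctValues {n : ℕ} (x : Fin n → I) : Finset I :=
  open Classical in Finset.univ.image x

/-- The number of data points equal to `y`. -/
noncomputable def multiplicity {n : ℕ} (x : Fin n → I) (y : I) : ℕ :=
  open Classical in (Finset.univ.filter fun i => x i = y).card

/-- The measure `R P + (1 - R) ∑ y, Δ y δ_y`, where `y` runs through a finite set `Y`. -/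
noncomputable def posteriorMixture (Y : Finset I)
    (p : (ℝ × ProbabilityMeasure I) × (Y → ℝ)) : Measure I :=
  ENNReal.ofReal p.1.1 • (p.1.2 : Measure I) + ENNReal.ofReal (1 - p.1.1) •
    Measure.sum fun y : Y => ENNReal.ofReal (p.2 y) • Measure.dirac (y : I)

theorem measurable_posteriorMixture (Y : Finset I) : Measurable (posteriorMixture Y) := by
  refine Measure.measurable_of_measurable_coe _ fun s hs => ?_
  simp only [posteriorMixture, Measure.add_apply, Measure.smul_apply, smul_eq_mul,
    Measure.sum_apply _ hs]
  refine Measurable.add (Measurable.mul (by fun_prop) ?_) (Measurable.mul (by fun_prop) ?_)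
  · exact (Measure.measurable_coe hs).comp (measurable_subtype_coe.comp (by fun_prop))
  · exact Measurable.tsum fun y => by fun_prop

/-- The posterior distribution, given data `x 0, …, x (n - 1)`, under the `(α, θ)`
Poisson–Dirichlet prior with base distribution `H`: with `k` distinct values `y` in the data, of
multiplicities `e y`, it is the law of `R P + (1 - R) ∑ y, Δ y δ_y`, where `R`, `P`, `Δ` are
independent, `R` is beta(`θ + k α`, `n - k α`), `P` is an `(α, θ + k α)` Poisson–Dirichlet process
with base distribution `H`, and `Δ` is Dirichlet with parameters `e y - α`. -/
noncomputable def posterior (α θ : ℝ) (H : ProbabilityMeasure I) {n : ℕ} (x : Fin n → I) :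
    ProbabilityMeasure (ProbabilityMeasure I) :=
  let k : ℕ := (distinctValues x).card
  (((betaLaw (θ + k * α) (n - k * α)).prod (poissonDirichlet α (θ + k * α) H)).prod
      (dirichletLaw fun y : distinctValues x => (multiplicity x (y : I) : ℝ) - α)).map
    (f := fun p => toProb H (posteriorMixture (distinctValues x) p))
    ((measurable_toProb H).comp (measurable_posteriorMixture _)).aemeasurable

/-- The mixture `α H + (1 - α) P`. -/
noncomputable def mixture (α : ℝ) (h₀ : 0 ≤ α) (h₁ : α ≤ 1) (H P : ProbabilityMeasure I) :
    ProbabilityMeasure I :=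
  ⟨ENNReal.ofReal α • (H : Measure I) + ENNReal.ofReal (1 - α) • (P : Measure I), ⟨by
    simp [← ENNReal.ofReal_add h₀ (sub_nonneg.2 h₁)]⟩⟩

end RandomMeasures

section Consistency

variable {I : Type*} [TopologicalSpace I] [PolishSpace I] [MeasurableSpace I] [BorelSpace I]

/-- Weak convergence of the posterior distributions, given the first `n` terms of the data
sequence `x`, to the point mass at `Q`, as `n → ∞`. -/
def PosteriorTendsto (α θ : ℝ) (H : ProbabilityMeasure I) (x : ℕ → I)
    (Q : ProbabilityMeasure I) : Prop :=
  Tendsto (fun n : ℕ => posterior α θ H fun i : Fin n => x i) atTop (𝓝 (diracProba Q))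

/-- Consistency at the true distribution `P₀`: for almost all sequences of independent data with
law `P₀`, the posterior converges weakly to the point mass at `P₀`. -/
def PosteriorConsistentAt (α θ : ℝ) (H P₀ : ProbabilityMeasure I) : Prop :=
  ∀ᵐ x ∂(Measure.infinitePi fun _ : ℕ => (P₀ : Measure I)), PosteriorTendsto α θ H x P₀

end Consistency

end PoissonDirichlet

/-! Non-atomicity of `P₀` makes the data almost surely distinct, so `k = n` and every multiplicity
is `1`. The posterior is then the law of `R P + (1 - R) ∑ Δ_i δ_{X_i}`, with `R` beta(`θ + nα`, `n -
nα`), `P` Poisson–Dirichlet(`α`, `θ + nα`) and `Δ` symmetric Dirichlet with parameter `1 - α`. For a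
measurable set `A`, each ingredient is controlled by a second moment and Chebyshev's inequality.

The mean of `R` is `(θ + nα)/(θ + n) → α` and its variance is at most `1/(θ + n)`. The mean square
deviation of `P(A)` from `H(A)` is at most the expected sum of squared stick weights, which
telescopes to `(1 - α)/(1 + θ + nα)` (`lintegral_poissonDirichlet_sub_sq_le`). For `α = 0` this need
not vanish, but it enters multiplied by `α²`. Writing `Δ` as normalized iid gamma variables, `∑
1_A(X_i) Δ_i` is close to the empirical mass of `A` (`dirichletLaw_const_le`), which tends to
`P₀(A)` by the strong law. `posterior_le_of_injective` combines the three estimates.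

Weak convergence to a point mass only requires countably many open sets `A`
(`tendsto_diracProba_of_forall_basicUnions`), so one null set of data sequences suffices.
Consistency then means `αH + (1 - α)P₀ = P₀`, by uniqueness of limits. -/

namespace PoissonDirichlet

/-! ### Weak convergence to a point mass, tested on countably many open sets -/

section WeakConvergence

theorem tendsto_diracProba_of_forall_nhds {X : Type*} [TopologicalSpace X] [MeasurableSpace X]
    [OpensMeasurableSpace X] [HasOuterApproxClosed X] {μs : ℕ → ProbabilityMeasure X} {x : X}
    (h : ∀ U ∈ 𝓝 x, Tendsto (fun n => (μs n : Measure X) Uᶜ) atTop (𝓝 0)) :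
    Tendsto μs atTop (𝓝 (diracProba x)) := by
  refine tendsto_of_forall_isOpen_le_liminf' fun G hG => ?_
  by_cases hx : x ∈ G
  · have h1 : Tendsto (fun n => (μs n : Measure X) G) atTop (𝓝 1) := by
      have h2 := ENNReal.Tendsto.sub (tendsto_const_nhds (x := (1 : ENNReal)) (f := atTop))
        (h G (hG.mem_nhds hx)) (by simp)
      simp only [tsub_zero] at h2
      refine h2.congr fun n => ?_
      rw [prob_compl_eq_one_sub hG.measurableSet,
        ENNReal.sub_sub_cancel ENNReal.one_ne_top prob_le_one]
    rw [h1.liminf_eq]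
    exact prob_le_one
  · have : (diracProba x : Measure X) G = 0 := by
      rw [diracProba_toMeasure_apply' _ hG.measurableSet]
      simp [hx]
    rw [this]
    exact zero_le

/-- The finite unions of members of a countable basis of the topology. -/
def basicUnions (I : Type*) [TopologicalSpace I] [SecondCountableTopology I] : Set (Set I) :=
  Set.sUnion '' {s | s.Finite ∧ s ⊆ TopologicalSpace.countableBasis I}

theorem countable_basicUnions {I : Type*} [TopologicalSpace I]
    [SecondCountableTopology I] : (basicUnions I).Countable :=
  (Set.countable_ofPred_finite_subset (TopologicalSpace.countable_countableBasis I)).image _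

theorem isOpen_of_mem_basicUnions {I : Type*} [TopologicalSpace I]
    [SecondCountableTopology I] {G : Set I} (hG : G ∈ basicUnions I) : IsOpen G := by
  obtain ⟨s, hs, rfl⟩ := hG
  exact isOpen_sUnion fun t ht => (TopologicalSpace.isBasis_countableBasis I).isOpen (hs.2 ht)

theorem exists_basicUnions_lt_measure {I : Type*} [TopologicalSpace I]
    [SecondCountableTopology I] [MeasurableSpace I] [OpensMeasurableSpace I] (Q : ProbabilityMeasure I) {G : Set I} (hG : IsOpen G)
    {r : NNReal} (hr : r < Q G) : ∃ T ∈ basicUnions I, r < Q T ∧ T ⊆ G := by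
  obtain ⟨T, hT, hrT, hTG⟩ := Q.exists_lt_measure_biUnion_of_isOpen
    (S := TopologicalSpace.countableBasis I) (fun u hu x hx => by
      obtain ⟨v, hv, hxv, hvu⟩ :=
        (TopologicalSpace.isBasis_countableBasis I).exists_subset_of_mem_open hx hu
      exact ⟨v, hv, ((TopologicalSpace.isBasis_countableBasis I).isOpen hv).mem_nhds hxv, hvu⟩)
    hG hr
  exact ⟨⋃ t ∈ T, t, ⟨(T : Set (Set I)), ⟨T.finite_toSet, fun t ht => hT t ht⟩,
    by simp [Set.sUnion_eq_biUnion]⟩, hrT, hTG⟩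

variable {I : Type*} [TopologicalSpace I] [PolishSpace I] [MeasurableSpace I] [BorelSpace I]

/-- By the portmanteau theorem it is enough to bound `liminf P(G)` below by `Q(G)` for open `G`.
Inner approximation of `G` by some `T` in `basicUnions I` gives this, since `P(G) ≥ P(T) → Q(T)`. -/
theorem iInf_comap_le_nhds (Q : ProbabilityMeasure I) :
    ⨅ G : basicUnions I, comap (fun P : ProbabilityMeasure I => P (G : Set I))
      (𝓝 (Q (G : Set I))) ≤ 𝓝 Q := by
  -- Countability of the index makes the infimum a countably generated filter, as the portmanteau
  -- criterion requires.
  have := countable_basicUnions (I := I).to_subtype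
  have ht : Tendsto (fun P : ProbabilityMeasure I => P)
      (⨅ G : basicUnions I, comap (fun P : ProbabilityMeasure I => P (G : Set I))
        (𝓝 (Q (G : Set I)))) (𝓝 Q) := by
    rcases (⨅ G : basicUnions I, comap (fun P : ProbabilityMeasure I => P (G : Set I))
      (𝓝 (Q (G : Set I)))).eq_or_neBot with h | h
    · simp [h]
    refine tendsto_of_forall_isOpen_le_liminf fun G hG => ?_
    refine le_of_forall_lt fun r hr => ?_
    obtain ⟨q, hrq, hq⟩ := exists_between hr
    obtain ⟨T, hT, hqT, hTG⟩ := exists_basicUnions_lt_measure Q hG hq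
    refine hrq.trans_le (le_liminf_of_le
      (isBoundedUnder_of ⟨1, by simp⟩ |>.isCoboundedUnder_ge) ?_)
    have h1 : Tendsto (fun P : ProbabilityMeasure I => P T)
        (⨅ G : basicUnions I, comap (fun P : ProbabilityMeasure I => P (G : Set I))
          (𝓝 (Q (G : Set I)))) (𝓝 (Q T)) :=
      tendsto_comap.mono_left (iInf_le _ (⟨T, hT⟩ : basicUnions I))
    filter_upwards [h1.eventually_const_lt hqT] with P hP
    exact hP.le.trans (P.apply_mono hTG)
  exact ht

/-- A sequence of laws on the space of probability measures converges weakly to the point mass at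
`Q` if the random masses of sufficiently many open sets converge to their values under `Q` in
probability. -/
theorem tendsto_diracProba_of_forall_basicUnions {μs : ℕ → ProbabilityMeasure (ProbabilityMeasure I)}
    {Q : ProbabilityMeasure I}
    (h : ∀ G ∈ basicUnions I, ∀ ε > 0, Tendsto (fun n => (μs n : Measure (ProbabilityMeasure I))
      {P | ε ≤ |(P : Measure I).real G - (Q : Measure I).real G|}) atTop (𝓝 0)) :
    Tendsto μs atTop (𝓝 (diracProba Q)) := by
  -- `K` consists of the sets whose complements have vanishing probability; convergence in
  -- probability to `Q` is `K ≤ 𝓝 Q`, which can be checked one open set at a time.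
  let K : Filter (ProbabilityMeasure I) :=
    { sets := {U | Tendsto (fun n => (μs n : Measure (ProbabilityMeasure I)) Uᶜ) atTop (𝓝 0)}
      univ_sets := by simp
      sets_of_superset := fun {U V} hU hUV =>
        tendsto_of_tendsto_of_tendsto_of_le_of_le tendsto_const_nhds hU (fun _ => zero_le)
          (fun n => measure_mono (Set.compl_subset_compl.2 hUV))
      inter_sets := fun {U V} hU hV => by
        have h0 := Tendsto.add hU hV
        rw [add_zero] at h0
        refine tendsto_of_tendsto_of_tendsto_of_le_of_le tendsto_const_nhds h0
          (fun _ => zero_le) fun n => ?_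
        simp only [Set.compl_inter]
        exact measure_union_le _ _ }
  have hK : K ≤ 𝓝 Q := by
    refine le_trans (le_iInf fun G => ?_) (iInf_comap_le_nhds Q)
    rw [← tendsto_iff_comap, Metric.tendsto_nhds]
    intro ε hε
    change Tendsto _ _ _
    convert! h G G.2 ε hε using 4 with n
    ext P
    simp [NNReal.dist_eq, measureReal_def, ProbabilityMeasure.coeFn_def]
    rfl
  exact tendsto_diracProba_of_forall_nhds fun U hU => hK hU

end WeakConvergence

/-! ### Second moments of the beta and gamma laws -/

section Moments

theorem betaLaw_coe {a b : ℝ} (ha : 0 < a) (hb : 0 < b) :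
    (betaLaw a b : Measure ℝ) = betaMeasure a b := by
  simp [betaLaw, ha, hb]

theorem gammaLaw_coe {a : ℝ} (ha : 0 < a) : (gammaLaw a : Measure ℝ) = gammaMeasure a 1 := by
  simp [gammaLaw, ha]

theorem ae_mem_Ioo_betaLaw {a b : ℝ} (ha : 0 < a) (hb : 0 < b) :
    ∀ᵐ x ∂(betaLaw a b : Measure ℝ), x ∈ Set.Ioo (0 : ℝ) 1 := by
  have hm : Measurable (betaPDF a b) := (measurable_betaPDFReal a b).ennreal_ofReal
  rw [betaLaw_coe ha hb, betaMeasure, ae_withDensity_iff hm]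
  refine ae_of_all _ fun x hx => ?_
  by_contra h
  apply hx
  rw [betaPDF_eq, if_neg (show ¬(0 < x ∧ x < 1) from h), ENNReal.ofReal_zero]

/-- Multiplying the beta(`a`, `b`) density by `x ^ i * (1 - x) ^ j` gives, up to the ratio of
normalizing constants, the beta(`a + i`, `b + j`) density. -/
theorem lintegral_betaLaw_pow_mul_pow {a b : ℝ} (ha : 0 < a) (hb : 0 < b) (i j : ℕ) :
    ∫⁻ x, ENNReal.ofReal (x ^ i * (1 - x) ^ j) ∂(betaLaw a b : Measure ℝ) =
      ENNReal.ofReal (beta (a + i) (b + j) / beta a b) := by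
  have ha' : 0 < a + i := by positivity
  have hb' : 0 < b + j := by positivity
  have hm : Measurable (betaPDF a b) := (measurable_betaPDFReal a b).ennreal_ofReal
  have hm' : Measurable (betaPDF (a + i) (b + j)) := (measurable_betaPDFReal _ _).ennreal_ofReal
  have hB := beta_pos ha hb
  have hB' := beta_pos ha' hb'
  rw [betaLaw_coe ha hb, betaMeasure, lintegral_withDensity_eq_lintegral_mul _ hm (by fun_prop)]
  have key : ∀ x, (betaPDF a b * fun x => ENNReal.ofReal (x ^ i * (1 - x) ^ j)) x =
      ENNReal.ofReal (beta (a + i) (b + j) / beta a b) * betaPDF (a + i) (b + j) x := by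
    intro x
    simp only [Pi.mul_apply]
    by_cases hx : 0 < x ∧ x < 1
    · have h1 : 0 < 1 - x := by linarith [hx.2]
      rw [betaPDF_of_pos_lt_one hx.1 hx.2, betaPDF_of_pos_lt_one hx.1 hx.2,
        ← ENNReal.ofReal_mul (by have := hx.1; positivity), ← ENNReal.ofReal_mul (by positivity)]
      congr 1
      have e1 : x ^ (a + i - 1) = x ^ (a - 1) * x ^ i := by
        rw [← Real.rpow_add_natCast hx.1.ne']; ring_nf
      have e2 : (1 - x) ^ (b + j - 1) = (1 - x) ^ (b - 1) * (1 - x) ^ j := by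
        rw [← Real.rpow_add_natCast h1.ne']; ring_nf
      rw [e1, e2]
      field_simp
    · simp [betaPDF_eq, hx]
  simp_rw [key]
  rw [lintegral_const_mul _ hm', lintegral_betaPDF_eq_one ha' hb', mul_one]

theorem beta_add_one_left {a b : ℝ} (ha : 0 < a) (hb : 0 < b) :
    beta (a + 1) b = a / (a + b) * beta a b := by
  have := Real.Gamma_pos_of_pos (add_pos ha hb)
  rw [beta, beta, Real.Gamma_add_one ha.ne', add_right_comm,
    Real.Gamma_add_one (add_pos ha hb).ne']
  field_simp

theorem beta_add_one_right {a b : ℝ} (ha : 0 < a) (hb : 0 < b) :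
    beta a (b + 1) = b / (a + b) * beta a b := by
  have := Real.Gamma_pos_of_pos (add_pos ha hb)
  rw [beta, beta, Real.Gamma_add_one hb.ne', ← add_assoc,
    Real.Gamma_add_one (add_pos ha hb).ne']
  field_simp

theorem lintegral_betaLaw_sq {a b : ℝ} (ha : 0 < a) (hb : 0 < b) :
    ∫⁻ x, ENNReal.ofReal (x ^ 2) ∂(betaLaw a b : Measure ℝ) =
      ENNReal.ofReal (a * (a + 1) / ((a + b) * (a + b + 1))) := by
  have h := lintegral_betaLaw_pow_mul_pow ha hb 2 0
  simp only [pow_zero, mul_one, Nat.cast_ofNat, Nat.cast_zero, add_zero] at h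
  rw [h, show a + 2 = a + 1 + 1 by ring, beta_add_one_left (by linarith) hb,
    beta_add_one_left ha hb]
  have := beta_pos ha hb
  congr 1
  rw [show a + 1 + b = a + b + 1 by ring]
  field_simp

theorem lintegral_betaLaw_one_sub_sq {a b : ℝ} (ha : 0 < a) (hb : 0 < b) :
    ∫⁻ x, ENNReal.ofReal ((1 - x) ^ 2) ∂(betaLaw a b : Measure ℝ) =
      ENNReal.ofReal (b * (b + 1) / ((a + b) * (a + b + 1))) := by
  have h := lintegral_betaLaw_pow_mul_pow ha hb 0 2
  simp only [pow_zero, one_mul, Nat.cast_ofNat, Nat.cast_zero, add_zero] at h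
  rw [h, show b + 2 = b + 1 + 1 by ring, beta_add_one_right ha (by linarith),
    beta_add_one_right ha hb]
  have := beta_pos ha hb
  congr 1
  rw [← add_assoc]
  field_simp

theorem lintegral_betaLaw_mul_one_sub {a b : ℝ} (ha : 0 < a) (hb : 0 < b) :
    ∫⁻ x, ENNReal.ofReal (x * (1 - x)) ∂(betaLaw a b : Measure ℝ) =
      ENNReal.ofReal (a * b / ((a + b) * (a + b + 1))) := by
  have h := lintegral_betaLaw_pow_mul_pow ha hb 1 1
  simp only [pow_one, Nat.cast_one] at h
  rw [h, beta_add_one_left ha (by linarith), beta_add_one_right ha hb]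
  have := beta_pos ha hb
  congr 1
  rw [← add_assoc]
  field_simp

/-- The variance of the beta(`a`, `b`) law. -/
theorem lintegral_betaLaw_sub_mean_sq {a b : ℝ} (ha : 0 < a) (hb : 0 < b) :
    ∫⁻ x, ENNReal.ofReal ((x - a / (a + b)) ^ 2) ∂(betaLaw a b : Measure ℝ) =
      ENNReal.ofReal (a * b / ((a + b) ^ 2 * (a + b + 1))) := by
  set m := a / (a + b) with hm
  have hm' : 1 - m = b / (a + b) := by rw [hm]; field_simp; ring
  have hm0 : 0 ≤ m := by positivity
  have hm1 : 0 ≤ 1 - m := by rw [hm']; positivity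
  -- Expand `(x - m)² = ((1 - m)x - m(1 - x))²` and move the cross term to the left, so that all
  -- terms are nonnegative on `(0, 1)` and no subtraction occurs under the integral.
  have h1 : ∫⁻ x, (ENNReal.ofReal ((x - m) ^ 2) +
        ENNReal.ofReal (2 * m * (1 - m)) * ENNReal.ofReal (x * (1 - x)))
        ∂(betaLaw a b : Measure ℝ) =
      ∫⁻ x, (ENNReal.ofReal ((1 - m) ^ 2) * ENNReal.ofReal (x ^ 2) +
        ENNReal.ofReal (m ^ 2) * ENNReal.ofReal ((1 - x) ^ 2)) ∂(betaLaw a b : Measure ℝ) := by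
    refine lintegral_congr_ae ?_
    filter_upwards [ae_mem_Ioo_betaLaw ha hb] with x hx
    have h1 : 0 ≤ 1 - x := by linarith [hx.2]
    have h0 : 0 ≤ x := hx.1.le
    rw [← ENNReal.ofReal_mul (by positivity), ← ENNReal.ofReal_mul (by positivity),
      ← ENNReal.ofReal_mul (by positivity), ← ENNReal.ofReal_add (by positivity) (by positivity),
      ← ENNReal.ofReal_add (by positivity) (by positivity)]
    congr 1
    ring
  rw [lintegral_add_left (by fun_prop), lintegral_add_left (by fun_prop),
    lintegral_const_mul _ (by fun_prop), lintegral_const_mul _ (by fun_prop),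
    lintegral_const_mul _ (by fun_prop), lintegral_betaLaw_sq ha hb,
    lintegral_betaLaw_one_sub_sq ha hb, lintegral_betaLaw_mul_one_sub ha hb,
    ← ENNReal.ofReal_mul (by positivity), ← ENNReal.ofReal_mul (by positivity),
    ← ENNReal.ofReal_mul (by positivity), ← ENNReal.ofReal_add (by positivity) (by positivity)] at h1
  rw [ENNReal.eq_sub_of_add_eq ENNReal.ofReal_ne_top h1, ← ENNReal.ofReal_sub _ (by positivity)]
  congr 1
  rw [hm', hm]
  field_simp
  ring

theorem ae_pos_gammaLaw {a : ℝ} (ha : 0 < a) : ∀ᵐ x ∂(gammaLaw a : Measure ℝ), 0 < x := by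
  have hm : Measurable (gammaPDF a 1) := (measurable_gammaPDFReal a 1).ennreal_ofReal
  have h0 : ∀ᵐ x ∂(gammaLaw a : Measure ℝ), 0 ≤ x := by
    rw [gammaLaw_coe ha, gammaMeasure, ae_withDensity_iff hm]
    refine ae_of_all _ fun x hx => ?_
    by_contra h
    exact hx (gammaPDF_of_neg (not_le.1 h))
  have h1 : ∀ᵐ x ∂(gammaLaw a : Measure ℝ), x ≠ 0 := by
    rw [gammaLaw_coe ha, gammaMeasure]
    exact (withDensity_absolutelyContinuous _ _).ae_le (Measure.ae_ne volume 0)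
  filter_upwards [h0, h1] with x hx hx' using lt_of_le_of_ne hx hx'.symm

theorem memLp_two_gammaLaw {a : ℝ} (ha : 0 < a) : MemLp id 2 (gammaLaw a : Measure ℝ) := by
  have hm : Measurable (gammaPDF a 1) := (measurable_gammaPDFReal a 1).ennreal_ofReal
  have hm' : Measurable (gammaPDF (a + 2) 1) := (measurable_gammaPDFReal _ 1).ennreal_ofReal
  rw [memLp_two_iff_integrable_sq (by fun_prop)]
  refine ⟨by fun_prop, ?_⟩
  rw [hasFiniteIntegral_iff_ofReal (ae_of_all _ fun x => sq_nonneg _), gammaLaw_coe ha, gammaMeasure,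
    lintegral_withDensity_eq_lintegral_mul _ hm (by fun_prop)]
  -- Again a shift of the shape parameter: `x²` times the gamma(`a`) density is a multiple of the
  -- gamma(`a + 2`) density.
  have key : ∀ x, (gammaPDF a 1 * fun x => ENNReal.ofReal (id x ^ 2)) x =
      ENNReal.ofReal (Real.Gamma (a + 2) / Real.Gamma a) * gammaPDF (a + 2) 1 x := by
    intro x
    have h1 := Real.Gamma_pos_of_pos ha
    have h2 := Real.Gamma_pos_of_pos (show 0 < a + 2 by linarith)
    simp only [Pi.mul_apply, id]
    rcases lt_trichotomy x 0 with hx | rfl | hx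
    · simp [gammaPDF_of_neg hx]
    · have : a + 2 - 1 ≠ 0 := by linarith
      simp [gammaPDF_of_nonneg, Real.zero_rpow this]
    · rw [gammaPDF_of_nonneg hx.le, gammaPDF_of_nonneg hx.le, ← ENNReal.ofReal_mul (by positivity),
        ← ENNReal.ofReal_mul (by positivity)]
      congr 1
      have e1 : x ^ (a + 2 - 1) = x ^ (a - 1) * x ^ 2 := by
        rw [← Real.rpow_add_natCast hx.ne']; push_cast; ring_nf
      rw [e1]
      simp only [Real.one_rpow]
      field_simp
  simp_rw [key]
  rw [lintegral_const_mul _ hm', lintegral_gammaPDF_eq_one (by linarith) one_pos, mul_one]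
  exact ENNReal.ofReal_lt_top

/-- Only the sign of the mean matters below: it occurs as a denominator in the Dirichlet estimate,
so its value is not computed. -/
theorem integral_gammaLaw_pos {a : ℝ} (ha : 0 < a) : 0 < ∫ x, x ∂(gammaLaw a : Measure ℝ) := by
  have hi : Integrable (fun x : ℝ => x) (gammaLaw a : Measure ℝ) :=
    (memLp_two_gammaLaw ha).integrable one_le_two
  have h0 := (ae_pos_gammaLaw ha).mono fun x hx => hx.le
  refine lt_of_le_of_ne (integral_nonneg_of_ae h0) fun h => ?_
  have h1 := (integral_eq_zero_iff_of_nonneg_ae h0 hi).1 h.symm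
  obtain ⟨x, hx, hx'⟩ := (h1.and (ae_pos_gammaLaw ha)).exists
  exact hx'.ne' hx

end Moments

/-! ### Concentration of the Poisson–Dirichlet process at its base distribution -/

section StickBreaking

variable {I : Type*} [MeasurableSpace I]

theorem measurable_measureReal {A : Set I} (hA : MeasurableSet A) :
    Measurable fun P : ProbabilityMeasure I => (P : Measure I).real A :=
  ((Measure.measurable_coe hA).comp measurable_subtype_coe).ennreal_toReal

theorem toProb_of_isProbabilityMeasure (Q : ProbabilityMeasure I) {μ : Measure I}
    (h : IsProbabilityMeasure μ) : ((toProb Q μ : ProbabilityMeasure I) : Measure I) = μ := by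
  simp [toProb, h]

/-- The left side is the variance of a sum of independent terms, the `k`-th having variance at most
`u k ^ 2`. Partial sums of weights need not be `1`, hence the centring by `(∑ u k) H(A)`. -/
theorem lintegral_weighted_sum_sub_sq_le (H : Measure I) [IsProbabilityMeasure H] {A : Set I}
    (hA : MeasurableSet A) {u : ℕ → ℝ} (s : Finset ℕ) :
    ∫⁻ z : ℕ → I, ENNReal.ofReal ((∑ k ∈ s, u k * (A.indicator 1 (z k) : ℝ) -
        (∑ k ∈ s, u k) * H.real A) ^ 2) ∂(Measure.infinitePi fun _ => H) ≤
      ENNReal.ofReal (∑ k ∈ s, u k ^ 2) := by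
  set μ : Measure (ℕ → I) := Measure.infinitePi fun _ => H
  have hm : Measurable (A.indicator 1 : I → ℝ) := measurable_one.indicator hA
  have hb : ∀ x, ‖(A.indicator 1 x : ℝ)‖ ≤ 1 := fun x => by
    by_cases hx : x ∈ A <;> simp [hx]
  let Y : ℕ → (ℕ → I) → ℝ := fun k z => u k * (A.indicator 1 (z k) : ℝ)
  have hYm : ∀ k, Measurable (Y k) := fun k => by
    exact measurable_const.mul (hm.comp (measurable_pi_apply k))
  have hY : ∀ k, MemLp (Y k) 2 μ := fun k =>
    MemLp.of_bound (hYm k).aestronglyMeasurable |u k| (ae_of_all _ fun z => by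
      simp only [Y, norm_mul, Real.norm_eq_abs]
      exact mul_le_of_le_one_right (abs_nonneg _) (hb _))
  have hmean : ∀ k, μ[Y k] = u k * H.real A := fun k => by
    have h1 : ∫ z, (A.indicator 1 (z k) : ℝ) ∂μ = ∫ x, (A.indicator 1 x : ℝ) ∂H := by
      rw [← Measure.infinitePi_map_eval (fun _ : ℕ => H) k,
        integral_map (measurable_pi_apply k).aemeasurable hm.aestronglyMeasurable]
    simp only [Y]
    rw [integral_const_mul, h1, integral_indicator_one hA]
  have hind : iIndepFun Y μ :=
    iIndepFun_infinitePi (P := fun _ : ℕ => H) (X := fun k x => u k * (A.indicator 1 x : ℝ))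
      (fun k => measurable_const.mul hm)
  have hvar : Var[∑ k ∈ s, Y k; μ] = ∑ k ∈ s, Var[Y k; μ] :=
    IndepFun.variance_sum (fun k _ => hY k) fun i _ j _ hij => hind.indepFun hij
  have hvarY : ∀ k, Var[Y k; μ] ≤ u k ^ 2 := fun k => by
    refine (variance_le_expectation_sq (hYm k).aestronglyMeasurable).trans ?_
    refine (integral_mono_of_nonneg (ae_of_all _ fun z => sq_nonneg _)
      (integrable_const (u k ^ 2)) (ae_of_all _ fun z => ?_)).trans (by simp)
    simp only [Pi.pow_apply, Y, mul_pow]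
    refine mul_le_of_le_one_right (sq_nonneg _) ?_
    have := hb (z k)
    rw [← sq_abs]
    exact pow_le_one₀ (abs_nonneg _) this
  have hsum : μ[∑ k ∈ s, Y k] = (∑ k ∈ s, u k) * H.real A := by
    simp only [Finset.sum_apply]
    rw [integral_finsetSum _ fun k _ => (hY k).integrable one_le_two, Finset.sum_mul]
    exact Finset.sum_congr rfl fun k _ => hmean k
  have hL : MemLp (∑ k ∈ s, Y k) 2 μ := memLp_finsetSum' _ fun k _ => hY k
  have hev := hL.ofReal_variance_eq
  rw [evariance_eq_lintegral_ofReal, hsum] at hev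
  calc _ = ENNReal.ofReal (Var[∑ k ∈ s, Y k; μ]) := by
        rw [hev]; simp only [Finset.sum_apply, Y]
    _ ≤ ENNReal.ofReal (∑ k ∈ s, u k ^ 2) :=
        ENNReal.ofReal_le_ofReal (hvar.trans_le (Finset.sum_le_sum fun k _ => hvarY k))

/-- A random discrete measure with fixed weights and independent atoms of law `H`: the variance of
the mass of a set is at most the sum of the squared weights. -/
theorem lintegral_tsum_sub_sq_le (H : Measure I) [IsProbabilityMeasure H] {A : Set I}
    (hA : MeasurableSet A) {w : ℕ → ENNReal} (hw : ∑' k, w k = 1) :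
    ∫⁻ z : ℕ → I, ENNReal.ofReal (((∑' k, w k * Measure.dirac (z k) A).toReal - H.real A) ^ 2)
      ∂(Measure.infinitePi fun _ => H) ≤ ∑' k, w k ^ 2 := by
  have hfin : ∀ k, w k ≠ ⊤ := fun k => ((ENNReal.le_tsum k).trans_lt (hw ▸ ENNReal.one_lt_top)).ne
  set u : ℕ → ℝ := fun k => (w k).toReal with hu
  have hwu : ∀ k, ENNReal.ofReal (u k) = w k := fun k => ENNReal.ofReal_toReal (hfin k)
  have hus : HasSum u 1 := by
    have h := ENNReal.hasSum_toReal (f := w) (by rw [hw]; simp)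
    rwa [← ENNReal.tsum_toReal_eq hfin, hw, ENNReal.toReal_one] at h
  have hm : Measurable (A.indicator 1 : I → ℝ) := measurable_one.indicator hA
  have hlim : ∀ z : ℕ → I, Tendsto (fun N => ENNReal.ofReal
      ((∑ k ∈ Finset.range N, u k * (A.indicator 1 (z k) : ℝ) -
        (∑ k ∈ Finset.range N, u k) * H.real A) ^ 2)) atTop
      (𝓝 (ENNReal.ofReal (((∑' k, w k * Measure.dirac (z k) A).toReal - H.real A) ^ 2))) := by
    intro z
    have hle : ∀ k, w k * Measure.dirac (z k) A ≤ w k := fun k =>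
      mul_le_of_le_one_right zero_le prob_le_one
    have h1 : HasSum (fun k => u k * (A.indicator 1 (z k) : ℝ))
        (∑' k, w k * Measure.dirac (z k) A).toReal := by
      have h := ENNReal.hasSum_toReal (f := fun k => w k * Measure.dirac (z k) A)
        (((ENNReal.tsum_le_tsum hle).trans_lt (hw ▸ ENNReal.one_lt_top)).ne)
      rw [← ENNReal.tsum_toReal_eq fun k => ((hle k).trans_lt (hfin k).lt_top).ne] at h
      convert h using 2 with k
      rw [ENNReal.toReal_mul, Measure.dirac_apply' _ hA]
      by_cases hz : z k ∈ A <;> simp [hz, u]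
    have h2 := (h1.tendsto_sum_nat.sub (hus.tendsto_sum_nat.mul_const (H.real A))).pow 2
    rw [one_mul] at h2
    exact (ENNReal.continuous_ofReal.tendsto _).comp h2
  -- Fatou's lemma carries the bound from partial sums to the whole series.
  calc _ = ∫⁻ z : ℕ → I, liminf (fun N => ENNReal.ofReal
        ((∑ k ∈ Finset.range N, u k * (A.indicator 1 (z k) : ℝ) -
          (∑ k ∈ Finset.range N, u k) * H.real A) ^ 2)) atTop ∂(Measure.infinitePi fun _ => H) :=
        lintegral_congr fun z => (hlim z).liminf_eq.symm
    _ ≤ liminf (fun N => ∫⁻ z : ℕ → I, ENNReal.ofReal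
        ((∑ k ∈ Finset.range N, u k * (A.indicator 1 (z k) : ℝ) -
          (∑ k ∈ Finset.range N, u k) * H.real A) ^ 2) ∂(Measure.infinitePi fun _ => H)) atTop :=
        lintegral_liminf_le fun N => by
          have : ∀ k, Measurable fun z : ℕ → I => (A.indicator 1 (z k) : ℝ) :=
            fun k => hm.comp (measurable_pi_apply k)
          fun_prop
    _ ≤ _ := by
        refine liminf_le_of_le (by isBoundedDefault) fun b hb => ?_
        obtain ⟨N, hN⟩ := hb.exists
        refine hN.trans ((lintegral_weighted_sum_sub_sq_le H hA _).trans ?_)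
        rw [ENNReal.ofReal_sum_of_nonneg fun k _ => sq_nonneg _]
        have hu2 : ∀ k, ENNReal.ofReal (u k ^ 2) = w k ^ 2 := fun k => by
          rw [ENNReal.ofReal_pow ENNReal.toReal_nonneg, hwu]
        simp only [hu2]
        exact ENNReal.sum_le_tsum _

theorem lintegral_prod_infinitePi {X : Type*} [MeasurableSpace X] (ν : ℕ → Measure X)
    [∀ j, IsProbabilityMeasure (ν j)] {f : ℕ → X → ENNReal} (hf : ∀ j, Measurable (f j))
    (s : Finset ℕ) :
    ∫⁻ v, ∏ j ∈ s, f j (v j) ∂(Measure.infinitePi ν) = ∏ j ∈ s, ∫⁻ x, f j x ∂(ν j) := by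
  refine (lintegral_prod_eq_prod_lintegral_of_indepFun s (fun j (v : ℕ → X) => f j (v j))
    (iIndepFun_infinitePi (P := ν) hf) fun j => (hf j).comp (measurable_pi_apply j)).trans ?_
  refine Finset.prod_congr rfl fun j _ => ?_
  rw [← Measure.infinitePi_map_eval ν j, lintegral_map (hf j) (measurable_pi_apply j)]

theorem lintegral_stick_sq_le_prod (ν : ℕ → Measure ℝ) [∀ j, IsProbabilityMeasure (ν j)] (k : ℕ) :
    ∫⁻ v, ENNReal.ofReal (v k * ∏ j ∈ Finset.range k, (1 - v j)) ^ 2 ∂(Measure.infinitePi ν) ≤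
      (∏ j ∈ Finset.range k, ∫⁻ x, ENNReal.ofReal ((1 - x) ^ 2) ∂(ν j)) *
        ∫⁻ x, ENNReal.ofReal (x ^ 2) ∂(ν k) := by
  let f : ℕ → ℝ → ENNReal := fun j x =>
    if j = k then ENNReal.ofReal (x ^ 2) else ENNReal.ofReal ((1 - x) ^ 2)
  have hf : ∀ j, Measurable (f j) := fun j => by
    by_cases h : j = k <;> simp only [f, h, if_true, if_false] <;> fun_prop
  have hle : ∀ v : ℕ → ℝ, ENNReal.ofReal (v k * ∏ j ∈ Finset.range k, (1 - v j)) ^ 2 ≤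
      ∏ j ∈ Finset.range (k + 1), f j (v j) := by
    intro v
    -- The sticks are not assumed to lie in `[0, 1]`; truncation of negative values only decreases
    -- the left side.
    have h1 : ∀ x : ℝ, ENNReal.ofReal x ^ 2 ≤ ENNReal.ofReal (x ^ 2) := fun x => by
      rcases le_total 0 x with h | h
      · rw [ENNReal.ofReal_pow h]
      · simp [ENNReal.ofReal_of_nonpos h]
    refine (h1 _).trans_eq ?_
    rw [Finset.prod_range_succ, mul_pow, mul_comm, ← Finset.prod_pow,
      ENNReal.ofReal_mul (Finset.prod_nonneg fun _ _ => sq_nonneg _),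
      ENNReal.ofReal_prod_of_nonneg fun _ _ => sq_nonneg _]
    congr 1
    · refine Finset.prod_congr rfl fun j hj => ?_
      simp [f, (Finset.mem_range.1 hj).ne]
    · simp [f]
  refine (lintegral_mono hle).trans_eq ?_
  rw [lintegral_prod_infinitePi ν hf, Finset.prod_range_succ]
  congr 1
  · refine Finset.prod_congr rfl fun j hj => ?_
    simp [f, (Finset.mem_range.1 hj).ne]
  · simp [f]

theorem lintegral_stick_sq_le {α θ : ℝ} (hα₀ : 0 ≤ α) (hα₁ : α < 1) (hθ : -α < θ) (k : ℕ) :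
    ∫⁻ v : ℕ → ℝ, ENNReal.ofReal (v k * ∏ j ∈ Finset.range k, (1 - v j)) ^ 2
      ∂(Measure.infinitePi fun k : ℕ => (betaLaw (1 - α) (θ + (k + 1) * α) : Measure ℝ)) ≤
    ENNReal.ofReal ((∏ j ∈ Finset.range k, ((θ + (j + 1) * α) * (θ + (j + 1) * α + 1) /
      ((1 + θ + j * α) * (1 + θ + j * α + 1)))) *
      ((1 - α) * (2 - α) / ((1 + θ + k * α) * (1 + θ + k * α + 1)))) := by
  have ha : 0 < 1 - α := by linarith
  have hpos : ∀ j : ℕ, 0 < θ + (j + 1) * α := fun j => by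
    have : 0 ≤ (j : ℝ) * α := by positivity
    nlinarith
  have hsum : ∀ j : ℕ, 1 - α + (θ + (j + 1) * α) = 1 + θ + j * α := fun j => by ring
  have hnn : ∀ j : ℕ, 0 ≤ (θ + (j + 1) * α) * (θ + (j + 1) * α + 1) /
      ((1 + θ + j * α) * (1 + θ + j * α + 1)) := fun j => by
    have h1 := hpos j
    have h2 : 0 < 1 + θ + j * α := by linarith [hsum j]
    positivity
  refine (lintegral_stick_sq_le_prod _ k).trans_eq ?_
  rw [ENNReal.ofReal_mul (Finset.prod_nonneg fun j _ => hnn j),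
    ENNReal.ofReal_prod_of_nonneg fun j _ => hnn j]
  congr 1
  · refine Finset.prod_congr rfl fun j _ => ?_
    rw [lintegral_betaLaw_one_sub_sq ha (hpos j), hsum]
  · rw [lintegral_betaLaw_sq ha (hpos k), hsum]
    congr 2
    ring

/-- The expected sum of squared weights of the two-parameter stick-breaking process. -/
theorem tsum_lintegral_stick_sq_le {α θ : ℝ} (hα₀ : 0 ≤ α) (hα₁ : α < 1) (hθ : -α < θ) :
    ∑' k : ℕ, ∫⁻ v : ℕ → ℝ, ENNReal.ofReal (v k * ∏ j ∈ Finset.range k, (1 - v j)) ^ 2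
      ∂(Measure.infinitePi fun k : ℕ => (betaLaw (1 - α) (θ + (k + 1) * α) : Measure ℝ)) ≤
    ENNReal.ofReal ((1 - α) / (1 + θ)) := by
  have ha : 0 < 1 - α := by linarith
  have hpos : ∀ j : ℕ, 0 < θ + (j + 1) * α := fun j => by
    have : 0 ≤ (j : ℝ) * α := by positivity
    nlinarith
  have hpos' : ∀ j : ℕ, 0 < 1 + θ + j * α := fun j => by have := hpos j; nlinarith
  let p : ℕ → ℝ := fun k => ∏ j ∈ Finset.range k, ((θ + (j + 1) * α) * (θ + (j + 1) * α + 1) /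
      ((1 + θ + j * α) * (1 + θ + j * α + 1)))
  have hp : ∀ k, 0 ≤ p k := fun k => Finset.prod_nonneg fun j _ => by
    have := hpos j
    have := hpos' j
    positivity
  -- Here `p k` is the mean square of the mass left after `k` sticks. What remains is a rescaled
  -- process with parameter `θ + kα`, so `B k` is the expected contribution of the sticks from index
  -- `k` on; this is why the second moments telescope as `B k - B (k + 1)`.
  let B : ℕ → ℝ := fun k => p k * ((1 - α) / (1 + θ + k * α))
  have hB : ∀ k, 0 ≤ B k := fun k => by
    have := hp k
    have := hpos' k
    positivity
  have hstep : ∀ k : ℕ, p k * ((1 - α) * (2 - α) / ((1 + θ + k * α) * (1 + θ + k * α + 1))) =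
      B k - B (k + 1) := fun k => by
    have h1 := hpos k
    have h2 := hpos' k
    have h3 := hpos' (k + 1)
    push_cast at h3
    have h4 : p (k + 1) = p k * ((θ + (k + 1) * α) * (1 + θ + (k + 1) * α) /
        ((1 + θ + k * α) * (1 + θ + k * α + 1))) := by
      simp only [p, Finset.prod_range_succ]
      rw [show θ + ((k : ℝ) + 1) * α + 1 = 1 + θ + (k + 1) * α by ring]
    change _ = p k * ((1 - α) / (1 + θ + k * α)) -
      p (k + 1) * ((1 - α) / (1 + θ + (k + 1 : ℕ) * α))
    rw [h4]
    have key : ∀ c x : ℝ, 0 < x → 0 < x + α → c * ((1 - α) * (2 - α) / (x * (x + 1))) =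
        c * ((1 - α) / x) - c * ((x + α - 1) * (x + α) / (x * (x + 1))) * ((1 - α) / (x + α)) := by
      intro c x hx hxα
      field_simp
      ring
    have e1 : 1 + θ + ((k + 1 : ℕ) : ℝ) * α = 1 + θ + k * α + α := by push_cast; ring
    have e2 : 1 + θ + ((k : ℝ) + 1) * α = 1 + θ + k * α + α := by ring
    have e3 : θ + ((k : ℝ) + 1) * α = 1 + θ + k * α + α - 1 := by ring
    rw [e1, e2, e3]
    exact key _ _ h2 (e2 ▸ h3)
  rw [ENNReal.tsum_eq_iSup_nat]
  refine iSup_le fun N => ?_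
  refine (Finset.sum_le_sum fun k _ => lintegral_stick_sq_le hα₀ hα₁ hθ k).trans ?_
  rw [← ENNReal.ofReal_sum_of_nonneg fun k _ => by
    have := hp k
    have := hpos' k
    have : 0 < 2 - α := by linarith
    simp only [p] at *
    positivity]
  refine ENNReal.ofReal_le_ofReal ?_
  rw [Finset.sum_congr rfl fun k _ => hstep k, Finset.sum_range_sub']
  have : B 0 = (1 - α) / (1 + θ) := by simp [B, p]
  linarith [hB N]

theorem stickBreaking_apply {p : (ℕ → ℝ) × (ℕ → I)} {A : Set I} (hA : MeasurableSet A) :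
    stickBreaking p A = ∑' k, ENNReal.ofReal (p.1 k * ∏ j ∈ Finset.range k, (1 - p.1 j)) *
      Measure.dirac (p.2 k) A := by
  simp [stickBreaking, Measure.sum_apply _ hA]

/-- The mean square deviation of the mass of a set under the two-parameter Poisson–Dirichlet process
from its mass under the base distribution. -/
theorem lintegral_poissonDirichlet_sub_sq_le {α θ : ℝ} (hα₀ : 0 ≤ α) (hα₁ : α < 1) (hθ : -α < θ)
    (H : ProbabilityMeasure I) {A : Set I} (hA : MeasurableSet A) :
    ∫⁻ P : ProbabilityMeasure I, ENNReal.ofReal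
        (((P : Measure I).real A - (H : Measure I).real A) ^ 2)
        ∂(poissonDirichlet α θ H : Measure (ProbabilityMeasure I)) ≤
      ENNReal.ofReal ((1 - α) / (1 + θ)) := by
  have hmP := measurable_measureReal hA
  have hg : Measurable fun P : ProbabilityMeasure I => ENNReal.ofReal
      (((P : Measure I).real A - (H : Measure I).real A) ^ 2) := by fun_prop
  have hst : Measurable fun p : (ℕ → ℝ) × (ℕ → I) => toProb H (stickBreaking p) :=
    (measurable_toProb H).comp measurable_stickBreaking
  rw [poissonDirichlet, ProbabilityMeasure.toMeasure_map, lintegral_map hg hst]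
  change ∫⁻ p, ENNReal.ofReal ((((toProb H (stickBreaking p) : ProbabilityMeasure I) :
    Measure I).real A - (H : Measure I).real A) ^ 2) ∂((Measure.infinitePi fun k : ℕ =>
      (betaLaw (1 - α) (θ + (k + 1) * α) : Measure ℝ)).prod
        (Measure.infinitePi fun _ : ℕ => (H : Measure I))) ≤ _
  refine (lintegral_prod _ (hg.comp hst).aemeasurable).trans_le ?_
  refine le_trans ?_ (tsum_lintegral_stick_sq_le hα₀ hα₁ hθ)
  rw [← lintegral_tsum fun k => by fun_prop]
  refine lintegral_mono fun v => ?_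
  -- If the weights fail to sum to `1`, `toProb` returns the default `H` and the deviation is zero,
  -- so almost sure total mass one is not needed.
  by_cases hv : ∑' k, ENNReal.ofReal (v k * ∏ j ∈ Finset.range k, (1 - v j)) = 1
  · refine le_trans (lintegral_mono fun z => ?_)
      (lintegral_tsum_sub_sq_le (H : Measure I) hA hv)
    have hp : IsProbabilityMeasure (stickBreaking (v, z)) :=
      ⟨by simpa [stickBreaking_apply MeasurableSet.univ] using hv⟩
    simp only [Function.comp_apply]
    rw [toProb_of_isProbabilityMeasure H hp, measureReal_def (stickBreaking (v, z)),
      stickBreaking_apply hA]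
  · have : ∀ z, toProb H (stickBreaking (v, z)) = H := fun z => by
      refine dif_neg fun hp => hv ?_
      simpa [stickBreaking_apply MeasurableSet.univ] using hp.measure_univ
    simp [this]

end StickBreaking

/-! ### Symmetric Dirichlet weights -/

section Dirichlet

variable {ι : Type*} [Fintype ι]

theorem dirichletLaw_coe (a : ι → ℝ) : (dirichletLaw a : Measure (ι → ℝ)) =
    (Measure.pi fun i => (gammaLaw (a i) : Measure ℝ)).map fun g i => g i / ∑ j, g j := rfl

theorem ae_pos_pi_gammaLaw {a : ι → ℝ} (ha : ∀ i, 0 < a i) :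
    ∀ᵐ g ∂(Measure.pi fun i => (gammaLaw (a i) : Measure ℝ)), ∀ i, 0 < g i := by
  rw [ae_all_iff]
  intro i
  exact (measurePreserving_eval (fun i => (gammaLaw (a i) : Measure ℝ)) i).quasiMeasurePreserving.ae
    (ae_pos_gammaLaw (ha i))

theorem ae_dirichletLaw [Nonempty ι] {a : ι → ℝ} (ha : ∀ i, 0 < a i) :
    ∀ᵐ d ∂(dirichletLaw a : Measure (ι → ℝ)), (∀ i, 0 ≤ d i) ∧ ∑ i, d i = 1 := by
  have hm : MeasurableSet {d : ι → ℝ | (∀ i, 0 ≤ d i) ∧ ∑ i, d i = 1} := by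
    simp only [Set.ofPred_and, Set.ofPred_forall]
    exact (MeasurableSet.iInter fun i => measurableSet_le measurable_const
      (measurable_pi_apply i)).inter (measurableSet_eq_fun (by fun_prop) measurable_const)
  rw [dirichletLaw_coe, ae_map_iff (by fun_prop) hm]
  filter_upwards [ae_pos_pi_gammaLaw ha] with g hg
  have hT : 0 < ∑ j, g j := Finset.sum_pos (fun i _ => hg i) Finset.univ_nonempty
  refine ⟨fun i => (div_pos (hg i) hT).le, ?_⟩
  rw [← Finset.sum_div, div_self hT.ne']

/-- Chebyshev's inequality for a linear combination of independent copies. -/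
theorem measure_pi_le_abs_sum_sub_le (ν : Measure ℝ) [IsProbabilityMeasure ν] (hν : MemLp id 2 ν)
    (d : ι → ℝ) {t : ℝ} (ht : 0 < t) :
    (Measure.pi fun _ : ι => ν) {g | t ≤ |∑ i, d i * g i - (∑ i, d i) * ∫ x, x ∂ν|} ≤
      ENNReal.ofReal (Var[id; ν] * (∑ i, d i ^ 2) / t ^ 2) := by
  have hX : ∀ i, MemLp (fun x : ℝ => d i * x) 2 ν := fun i => hν.const_mul (d i)
  have hY : ∀ i, MemLp (fun g : ι → ℝ => d i * g i) 2 (Measure.pi fun _ : ι => ν) := fun i =>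
    (hX i).comp_measurePreserving (measurePreserving_eval (fun _ : ι => ν) i)
  have hL : MemLp (∑ i, fun g : ι → ℝ => d i * g i) 2 (Measure.pi fun _ : ι => ν) :=
    memLp_finsetSum' _ fun i _ => hY i
  have hmean : ∫ g, (∑ i, fun g : ι → ℝ => d i * g i) g ∂(Measure.pi fun _ : ι => ν) =
      (∑ i, d i) * ∫ x, x ∂ν := by
    simp only [Finset.sum_apply]
    rw [integral_finsetSum _ fun i _ => (hY i).integrable one_le_two, Finset.sum_mul]
    refine Finset.sum_congr rfl fun i _ => ?_
    rw [integral_const_mul]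
    congr 1
    have h := integral_map (μ := Measure.pi fun _ : ι => ν) (φ := Function.eval i)
      (f := fun x : ℝ => x) (measurable_pi_apply i).aemeasurable (by fun_prop)
    rw [(measurePreserving_eval (fun _ : ι => ν) i).map_eq] at h
    exact h.symm
  have hvar : Var[∑ i, fun g : ι → ℝ => d i * g i; Measure.pi fun _ : ι => ν] =
      Var[id; ν] * ∑ i, d i ^ 2 := by
    rw [variance_sum_pi (X := fun i (x : ℝ) => d i * x) hX, Finset.mul_sum]
    refine Finset.sum_congr rfl fun i _ => ?_
    rw [variance_const_mul, mul_comm]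
    rfl
  have h := meas_ge_le_variance_div_sq hL ht
  rw [hmean, hvar] at h
  simpa only [Finset.sum_apply] using h

/-- A weak law of large numbers for symmetric Dirichlet weights. -/
theorem dirichletLaw_const_le [Nonempty ι] {a : ℝ} (ha : 0 < a) {ε : ℝ} (hε : 0 < ε) {c : ι → ℝ}
    (hc : ∀ i, c i ∈ Set.Icc (0 : ℝ) 1) :
    (dirichletLaw fun _ : ι => a : Measure (ι → ℝ))
        {d | ε ≤ |∑ i, c i * d i - (∑ i, c i) / Fintype.card ι|} ≤
      ENNReal.ofReal ((Var[id; (gammaLaw a : Measure ℝ)] *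
        (4 / (ε * ∫ x, x ∂(gammaLaw a : Measure ℝ)) ^ 2 +
          4 / (∫ x, x ∂(gammaLaw a : Measure ℝ)) ^ 2)) / Fintype.card ι) := by
  set ν : Measure ℝ := (gammaLaw a : Measure ℝ)
  set m := ∫ x, x ∂ν
  set v := Var[id; ν]
  set n : ℝ := (Fintype.card ι : ℝ)
  set b := (∑ i, c i) / n
  have hm : 0 < m := integral_gammaLaw_pos ha
  have hv : 0 ≤ v := variance_nonneg _ _
  have hn : 0 < n := by simp only [n]; exact_mod_cast Fintype.card_pos
  have hν : MemLp id 2 ν := memLp_two_gammaLaw ha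
  have hnb : n * b = ∑ i, c i := mul_div_cancel₀ _ hn.ne'
  have hb0 : 0 ≤ b := div_nonneg (Finset.sum_nonneg fun i _ => (hc i).1) hn.le
  have hb1 : b ≤ 1 := by
    refine (div_le_one hn).2 ((Finset.sum_le_sum fun i _ => (hc i).2).trans ?_)
    simp [n]
  have hcb0 : ∑ i, (c i - b) = 0 := by
    rw [Finset.sum_sub_distrib, ← hnb]
    simp [n]
  have hcb2 : ∑ i, (c i - b) ^ 2 ≤ n := by
    refine (Finset.sum_le_sum (g := fun _ => (1 : ℝ)) fun i _ => ?_).trans (by simp [n])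
    have := hc i
    rw [sq_le_one_iff_abs_le_one, abs_le]
    constructor <;> linarith [this.1, this.2]
  -- The deviation equals `∑ (c i - b) g i / ∑ g j`, whose numerator has mean zero. Unless the
  -- denominator falls to `nm/2` or below, a deviation of `ε` forces the numerator above `ε nm/2`;
  -- these are the two thresholds.
  have h1 := measure_pi_le_abs_sum_sub_le ν hν (fun i : ι => c i - b) (t := ε * (n * m) / 2)
    (by positivity)
  have h2 := measure_pi_le_abs_sum_sub_le ν hν (fun _ : ι => 1) (t := n * m / 2) (by positivity)
  have hms : MeasurableSet {d : ι → ℝ | ε ≤ |∑ i, c i * d i - b|} :=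
    measurableSet_le measurable_const (by fun_prop)
  rw [dirichletLaw_coe, Measure.map_apply (by fun_prop) hms]
  refine (measure_mono_ae ?_).trans ((measure_union_le
    {g : ι → ℝ | ε * (n * m) / 2 ≤ |∑ i, (c i - b) * g i - (∑ i, (c i - b)) * ∫ x, x ∂ν|}
    {g : ι → ℝ | n * m / 2 ≤ |∑ i, 1 * g i - (∑ i : ι, 1) * ∫ x, x ∂ν|}).trans
      ((add_le_add h1 h2).trans ?_))
  · filter_upwards [ae_pos_pi_gammaLaw (fun _ : ι => ha)] with g hg hgε
    have hT : 0 < ∑ j, g j := Finset.sum_pos (fun i _ => hg i) Finset.univ_nonempty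
    by_contra hcon
    change ¬ (_ ∨ _) at hcon
    push Not at hcon
    obtain ⟨hcon1, hcon2⟩ := hcon
    simp only [Set.mem_ofPred_eq, not_le, hcb0, zero_mul, sub_zero, one_mul] at hcon1 hcon2
    have hcard : (∑ _i : ι, (1 : ℝ)) = n := by simp [n]
    rw [hcard] at hcon2
    change |∑ j, g j - n * m| < _ at hcon2
    change ε ≤ |∑ i, c i * (g i / ∑ j, g j) - b| at hgε
    have e : ∑ i, c i * (g i / ∑ j, g j) - b = (∑ i, (c i - b) * g i) / ∑ j, g j := by
      simp only [sub_mul, Finset.sum_sub_distrib, ← Finset.mul_sum, ← mul_div_assoc,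
        ← Finset.sum_div]
      field_simp
    rw [e, abs_div, abs_of_pos hT, le_div_iff₀ hT] at hgε
    have := (abs_lt.1 hcon2).1
    nlinarith
  · rw [← ENNReal.ofReal_add (by positivity) (by positivity)]
    refine ENNReal.ofReal_le_ofReal ?_
    have hcard : (∑ _i : ι, (1 : ℝ) ^ 2) = n := by simp [n]
    rw [hcard]
    calc _ ≤ v * n / (ε * (n * m) / 2) ^ 2 + v * n / (n * m / 2) ^ 2 := by gcongr
      _ = _ := by field_simp; ring

end Dirichlet

/-! ### Almost sure properties of the data -/

section Data

variable {I : Type*} [MeasurableSpace I]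

theorem ae_injective_infinitePi [MeasurableEq I] (P₀ : Measure I) [IsProbabilityMeasure P₀]
    [NullSingletonClass P₀] :
    ∀ᵐ x ∂(Measure.infinitePi fun _ : ℕ => P₀), Function.Injective x := by
  -- By Fubini: the sections of the diagonal are singletons, which are null for `P₀`.
  have hdiag : (P₀.prod P₀) (Set.diagonal I) = 0 := by
    rw [Measure.prod_apply measurableSet_diagonal]
    have : ∀ x : I, Prod.mk x ⁻¹' Set.diagonal I = {x} := fun x => by
      ext y; simp [eq_comm]
    simp [this]
  have h : ∀ᵐ x ∂(Measure.infinitePi fun _ : ℕ => P₀), ∀ i j : ℕ, i ≠ j → x i ≠ x j := by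
    rw [ae_all_iff]
    intro i
    rw [ae_all_iff]
    intro j
    by_cases hij : i = j
    · simp [hij]
    rw [← Measure.infinitePi_map_eval_prod (P := fun _ : ℕ => P₀) hij,
      Measure.map_apply (by fun_prop) measurableSet_diagonal] at hdiag
    filter_upwards [measure_eq_zero_iff_ae_notMem.1 hdiag] with x hx _
    exact hx
  filter_upwards [h] with x hx i j hij
  by_contra hne
  exact hx i j hne hij

theorem ae_tendsto_empirical (P₀ : Measure I) [IsProbabilityMeasure P₀] {A : Set I}
    (hA : MeasurableSet A) :
    ∀ᵐ x ∂(Measure.infinitePi fun _ : ℕ => P₀), Tendsto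
      (fun n : ℕ => (∑ i ∈ Finset.range n, (A.indicator 1 (x i) : ℝ)) / n) atTop
      (𝓝 (P₀.real A)) := by
  have hm : Measurable (A.indicator 1 : I → ℝ) := measurable_one.indicator hA
  have hXm : ∀ i : ℕ, Measurable fun x : ℕ → I => (A.indicator 1 (x i) : ℝ) :=
    fun i => hm.comp (measurable_pi_apply i)
  have hmap : ∀ i : ℕ, (Measure.infinitePi fun _ : ℕ => P₀).map
      (fun x => (A.indicator 1 (x i) : ℝ)) = P₀.map (A.indicator 1) := fun i => by
    conv_rhs => rw [← Measure.infinitePi_map_eval (fun _ : ℕ => P₀) i]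
    rw [Measure.map_map hm (measurable_pi_apply i)]
    rfl
  have h := strong_law_ae_real (μ := Measure.infinitePi fun _ : ℕ => P₀)
    (fun i x => (A.indicator 1 (x i) : ℝ)) (Integrable.of_bound (hXm 0).aestronglyMeasurable 1
      (ae_of_all _ fun x => by by_cases hx : x 0 ∈ A <;> simp [hx]))
    (fun i j hij => (iIndepFun_infinitePi (P := fun _ : ℕ => P₀)
      (X := fun _ : ℕ => (A.indicator 1 : I → ℝ)) fun _ => hm).indepFun hij)
    (fun i => ⟨(hXm i).aemeasurable, (hXm 0).aemeasurable, by rw [hmap, hmap]⟩)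
  have hmean : ∫ x : ℕ → I, (A.indicator 1 (x 0) : ℝ) ∂(Measure.infinitePi fun _ : ℕ => P₀) =
      P₀.real A := by
    have h1 := integral_map (μ := Measure.infinitePi fun _ : ℕ => P₀) (φ := fun x : ℕ → I => x 0)
      (f := (A.indicator 1 : I → ℝ)) (measurable_pi_apply 0).aemeasurable hm.aestronglyMeasurable
    rw [Measure.infinitePi_map_eval (fun _ : ℕ => P₀) 0, integral_indicator_one hA] at h1
    exact h1.symm
  rwa [hmean] at h

end Data

/-! ### The posterior for distinct data -/

section PosteriorBound

theorem card_distinctValues {I : Type*} {n : ℕ} {x : Fin n → I} (hx : Function.Injective x) :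
    (distinctValues x).card = n := by
  classical
  simp [distinctValues, Finset.card_image_of_injective _ hx]

theorem multiplicity_eq_one {I : Type*} {n : ℕ} {x : Fin n → I} (hx : Function.Injective x)
    (y : distinctValues x) : multiplicity x (y : I) = 1 := by
  classical
  have hy := y.2
  simp only [distinctValues, Finset.mem_image] at hy
  obtain ⟨i, -, hi⟩ := hy
  rw [multiplicity, Finset.card_eq_one]
  refine ⟨i, ?_⟩
  ext j
  simp [← hi, hx.eq_iff]

theorem sum_distinctValues {I : Type*} {n : ℕ} {x : Fin n → I} (hx : Function.Injective x)
    (f : I → ℝ) :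
    ∑ y : distinctValues x, f y = ∑ i, f (x i) := by
  classical
  rw [Finset.sum_coe_sort (distinctValues x) f]
  simp [distinctValues, Finset.sum_image hx.injOn]

variable {I : Type*} [MeasurableSpace I]

theorem measure_le_abs_le {Ω : Type*} [MeasurableSpace Ω] (μ : Measure Ω) {f : Ω → ℝ}
    (hf : Measurable f) {t : ℝ} (ht : 0 < t) :
    μ {ω | t ≤ |f ω|} ≤ (∫⁻ ω, ENNReal.ofReal (f ω ^ 2) ∂μ) / ENNReal.ofReal (t ^ 2) := by
  refine le_trans (measure_mono fun ω hω => ?_) (meas_ge_le_lintegral_div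
    (f := fun ω => ENNReal.ofReal (f ω ^ 2)) (by fun_prop) (by simpa using ht.ne') (by simp))
  refine ENNReal.ofReal_le_ofReal ?_
  rw [← sq_abs (f ω)]
  exact pow_le_pow_left₀ ht.le hω 2

theorem posterior_of_injective (α θ : ℝ) (H : ProbabilityMeasure I) {n : ℕ} {x : Fin n → I}
    (hx : Function.Injective x) :
    (posterior α θ H x : Measure (ProbabilityMeasure I)) =
      ((((betaLaw (θ + n * α) (n - n * α) : Measure ℝ).prod
        (poissonDirichlet α (θ + n * α) H : Measure (ProbabilityMeasure I))).prod
        (dirichletLaw fun _ : distinctValues x => 1 - α : Measure (distinctValues x → ℝ)))).map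
      fun p => toProb H (posteriorMixture (distinctValues x) p) := by
  have h1 : (fun y : distinctValues x => (multiplicity x (y : I) : ℝ) - α) = fun _ => 1 - α :=
    funext fun y => by rw [multiplicity_eq_one hx, Nat.cast_one]
  have h2 : posterior α θ H x =
      (((betaLaw (θ + (distinctValues x).card * α) (n - (distinctValues x).card * α)).prod
        (poissonDirichlet α (θ + (distinctValues x).card * α) H)).prod
        (dirichletLaw fun y : distinctValues x => (multiplicity x (y : I) : ℝ) - α)).map
      (f := fun p => toProb H (posteriorMixture (distinctValues x) p))
      ((measurable_toProb H).comp (measurable_posteriorMixture _)).aemeasurable := rfl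
  rw [h2, h1, card_distinctValues hx]
  rfl

theorem toProb_posteriorMixture_real (Q : ProbabilityMeasure I) (Y : Finset I) {r : ℝ}
    (hr : r ∈ Set.Icc (0 : ℝ) 1) (P : ProbabilityMeasure I) {d : Y → ℝ} (hd : ∀ y, 0 ≤ d y)
    (hd1 : ∑ y, d y = 1) {A : Set I} (hA : MeasurableSet A) :
    ((toProb Q (posteriorMixture Y ((r, P), d)) : ProbabilityMeasure I) : Measure I).real A =
      r * (P : Measure I).real A + (1 - r) * ∑ y : Y, (A.indicator 1 (y : I) : ℝ) * d y := by
  have hr1 : 0 ≤ 1 - r := sub_nonneg.2 hr.2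
  have happ : ∀ B : Set I, MeasurableSet B → posteriorMixture Y ((r, P), d) B =
      ENNReal.ofReal (r * (P : Measure I).real B +
        (1 - r) * ∑ y : Y, (B.indicator 1 (y : I) : ℝ) * d y) := by
    intro B hB
    have hn : ∀ y : Y, 0 ≤ (B.indicator 1 (y : I) : ℝ) * d y := fun y =>
      mul_nonneg (Set.indicator_nonneg (fun _ _ => zero_le_one) _) (hd y)
    rw [ENNReal.ofReal_add (mul_nonneg hr.1 measureReal_nonneg)
      (mul_nonneg hr1 (Finset.sum_nonneg fun y _ => hn y)), ENNReal.ofReal_mul hr.1,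
      ENNReal.ofReal_mul hr1, ENNReal.ofReal_sum_of_nonneg fun y _ => hn y, ofReal_measureReal]
    simp only [posteriorMixture, Measure.add_apply, Measure.smul_apply, smul_eq_mul,
      Measure.sum_apply _ hB, tsum_fintype, Measure.dirac_apply' _ hB]
    congr 2
    refine Finset.sum_congr rfl fun y _ => ?_
    by_cases hy : (y : I) ∈ B <;> simp [hy]
  have hp : IsProbabilityMeasure (posteriorMixture Y ((r, P), d)) :=
    ⟨by
      rw [happ _ MeasurableSet.univ]
      simp only [Set.indicator_univ, Pi.one_apply, one_mul, hd1, probReal_univ]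
      simp⟩
  rw [toProb_of_isProbabilityMeasure Q hp, measureReal_def, happ A hA, ENNReal.toReal_ofReal]
  exact add_nonneg (mul_nonneg hr.1 measureReal_nonneg) (mul_nonneg hr1
    (Finset.sum_nonneg fun y _ => mul_nonneg (Set.indicator_nonneg (fun _ _ => zero_le_one) _) (hd y)))

/-- With `D = ∑ 1_A(y) Δ_y`, the deviation splits as `(R - α)(P(A) - D) + α(P(A) - H(A)) + (1 - α)(D
- p)`. Since `|P(A) - D| ≤ 1` and `0 ≤ 1 - α ≤ 1`, a total of `3ε` forces one of the three events.
The number `p` is later taken to be the empirical mass of `A`. -/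
theorem posterior_le_of_injective {α θ : ℝ} (hα₀ : 0 ≤ α) (hα₁ : α < 1) (H : ProbabilityMeasure I)
    {n : ℕ} (hn : 0 < n) (hθ : 0 < θ + n * α) {x : Fin n → I} (hx : Function.Injective x)
    {A : Set I} (hA : MeasurableSet A) (ε p : ℝ) :
    (posterior α θ H x : Measure (ProbabilityMeasure I))
        {P | 3 * ε ≤ |(P : Measure I).real A - (α * (H : Measure I).real A + (1 - α) * p)|} ≤
      (betaLaw (θ + n * α) (n - n * α) : Measure ℝ) {r | ε ≤ |r - α|} +
      (poissonDirichlet α (θ + n * α) H : Measure (ProbabilityMeasure I))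
        {P | ε ≤ |α * ((P : Measure I).real A - (H : Measure I).real A)|} +
      (dirichletLaw fun _ : distinctValues x => 1 - α : Measure (distinctValues x → ℝ))
        {d | ε ≤ |∑ y : distinctValues x, (A.indicator 1 (y : I) : ℝ) * d y - p|} := by
  have hb : 0 < (n : ℝ) - n * α := by
    have : (0 : ℝ) < n := by exact_mod_cast hn
    nlinarith
  have hne : Nonempty (distinctValues x) := by
    rw [Finset.nonempty_coe_sort, ← Finset.card_pos, card_distinctValues hx]
    exact hn
  have hmA := measurable_measureReal hA
  set μ₁ : Measure ℝ := (betaLaw (θ + n * α) (n - n * α) : Measure ℝ)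
  set μ₂ : Measure (ProbabilityMeasure I) := (poissonDirichlet α (θ + n * α) H :
    Measure (ProbabilityMeasure I))
  set μ₃ : Measure (distinctValues x → ℝ) :=
    (dirichletLaw fun _ : distinctValues x => 1 - α : Measure (distinctValues x → ℝ))
  set B₁ : Set ℝ := {r | ε ≤ |r - α|}
  set B₂ : Set (ProbabilityMeasure I) :=
    {P | ε ≤ |α * ((P : Measure I).real A - (H : Measure I).real A)|}
  set B₃ : Set (distinctValues x → ℝ) :=
    {d | ε ≤ |∑ y : distinctValues x, (A.indicator 1 (y : I) : ℝ) * d y - p|}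
  have hB₁ : MeasurableSet B₁ := measurableSet_le measurable_const (by fun_prop)
  have hB₂ : MeasurableSet B₂ := measurableSet_le measurable_const (by fun_prop)
  have hB₃ : MeasurableSet B₃ := measurableSet_le measurable_const (by fun_prop)
  have hmt : Measurable fun q => toProb H (posteriorMixture (distinctValues x) q) :=
    (measurable_toProb H).comp (measurable_posteriorMixture _)
  rw [posterior_of_injective α θ H hx, Measure.map_apply hmt
    (measurableSet_le measurable_const (by fun_prop))]
  -- Each event involves a single component, so only marginals enter the union bound.
  have e₁ : ((μ₁.prod μ₂).prod μ₃) ((fun q => q.1.1) ⁻¹' B₁) = μ₁ B₁ :=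
    (measurePreserving_fst.comp measurePreserving_fst).measure_preimage hB₁.nullMeasurableSet
  have e₂ : ((μ₁.prod μ₂).prod μ₃) ((fun q => q.1.2) ⁻¹' B₂) = μ₂ B₂ :=
    (measurePreserving_snd.comp measurePreserving_fst).measure_preimage hB₂.nullMeasurableSet
  have e₃ : ((μ₁.prod μ₂).prod μ₃) ((fun q => q.2) ⁻¹' B₃) = μ₃ B₃ :=
    measurePreserving_snd.measure_preimage hB₃.nullMeasurableSet
  have a₁ : ∀ᵐ q ∂((μ₁.prod μ₂).prod μ₃), q.1.1 ∈ Set.Ioo (0 : ℝ) 1 :=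
    (measurePreserving_fst.comp (measurePreserving_fst (μ := μ₁.prod μ₂)
      (ν := μ₃))).quasiMeasurePreserving.ae (ae_mem_Ioo_betaLaw hθ hb)
  have a₃ : ∀ᵐ q ∂((μ₁.prod μ₂).prod μ₃), (∀ y, 0 ≤ q.2 y) ∧ ∑ y, q.2 y = 1 :=
    (measurePreserving_snd (μ := μ₁.prod μ₂) (ν := μ₃)).quasiMeasurePreserving.ae
      (ae_dirichletLaw fun _ => by linarith)
  rw [← e₁, ← e₂, ← e₃]
  refine (measure_mono_ae ?_).trans ((measure_union_le _ _).trans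
    (add_le_add_left (measure_union_le _ _) _))
  filter_upwards [a₁, a₃] with q hq₁ hq₃ hq
  obtain ⟨⟨r, P⟩, d⟩ := q
  change 3 * ε ≤ |((toProb H (posteriorMixture (distinctValues x) ((r, P), d)) :
    ProbabilityMeasure I) : Measure I).real A - _| at hq
  rw [toProb_posteriorMixture_real H _ ⟨hq₁.1.le, hq₁.2.le⟩ P hq₃.1 hq₃.2 hA] at hq
  change ((ε ≤ |r - α|) ∨ (ε ≤ |α * ((P : Measure I).real A - (H : Measure I).real A)|)) ∨
    (ε ≤ |∑ y : distinctValues x, (A.indicator 1 (y : I) : ℝ) * d y - p|)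
  by_contra hcon
  push Not at hcon
  obtain ⟨⟨h1, h2⟩, h3⟩ := hcon
  set D := ∑ y : distinctValues x, (A.indicator 1 (y : I) : ℝ) * d y
  have hD0 : 0 ≤ D := Finset.sum_nonneg fun y _ =>
    mul_nonneg (Set.indicator_nonneg (fun _ _ => zero_le_one) _) (hq₃.1 y)
  have hD1 : D ≤ 1 := by
    rw [← hq₃.2]
    refine Finset.sum_le_sum fun y _ => mul_le_of_le_one_left (hq₃.1 y) ?_
    by_cases hy : (y : I) ∈ A <;> simp [hy]
  have hP0 : 0 ≤ (P : Measure I).real A := measureReal_nonneg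
  have hP1 : (P : Measure I).real A ≤ 1 := measureReal_le_one
  have e : r * (P : Measure I).real A + (1 - r) * D -
      (α * (H : Measure I).real A + (1 - α) * p) = (r - α) * ((P : Measure I).real A - D) +
      α * ((P : Measure I).real A - (H : Measure I).real A) + (1 - α) * (D - p) := by ring
  have t1 : |(r - α) * ((P : Measure I).real A - D)| < ε := by
    rw [abs_mul]
    refine (mul_le_of_le_one_right (abs_nonneg _) ?_).trans_lt h1
    rw [abs_le]
    constructor <;> linarith
  have t3 : |(1 - α) * (D - p)| < ε := by
    rw [abs_mul]
    refine (mul_le_of_le_one_left (abs_nonneg _) ?_).trans_lt h3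
    rw [abs_le]
    constructor <;> linarith
  rw [e] at hq
  have := abs_add_three ((r - α) * ((P : Measure I).real A - D))
    (α * ((P : Measure I).real A - (H : Measure I).real A)) ((1 - α) * (D - p))
  linarith

end PosteriorBound

/-! ### Passage to the limit -/

section Limits

variable {I : Type*} [MeasurableSpace I]

theorem betaLaw_le_abs_sub_le {a b : ℝ} (ha : 0 < a) (hb : 0 < b) {m ε : ℝ} (hε : 0 < ε)
    (hm : |a / (a + b) - m| < ε / 2) :
    (betaLaw a b : Measure ℝ) {r | ε ≤ |r - m|} ≤
      ENNReal.ofReal (1 / (a + b)) / ENNReal.ofReal ((ε / 2) ^ 2) := by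
  calc _ ≤ (betaLaw a b : Measure ℝ) {r | ε / 2 ≤ |r - a / (a + b)|} := by
        refine measure_mono fun r hr => ?_
        change ε / 2 ≤ |r - a / (a + b)|
        change ε ≤ |r - m| at hr
        linarith [abs_sub_le r (a / (a + b)) m]
    _ ≤ _ := measure_le_abs_le _ (by fun_prop) (by positivity)
    _ ≤ _ := by
        rw [lintegral_betaLaw_sub_mean_sq ha hb]
        refine ENNReal.div_le_div_right (ENNReal.ofReal_le_ofReal ?_) _
        rw [div_le_div_iff₀ (by positivity) (by positivity)]
        have : 0 < a * b := by positivity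
        nlinarith [mul_pos ha (add_pos ha hb), mul_pos hb (add_pos ha hb), pow_pos (add_pos ha hb) 3]

/-- The factor `c` is kept inside the event because it is applied with `c = α`: for `α = 0` the
bound is zero although the process itself does not concentrate as `n` grows. -/
theorem poissonDirichlet_le_abs_sub_le {α θ : ℝ} (hα₀ : 0 ≤ α) (hα₁ : α < 1) (hθ : -α < θ)
    (H : ProbabilityMeasure I) {A : Set I} (hA : MeasurableSet A) {ε : ℝ} (hε : 0 < ε) (c : ℝ) :
    (poissonDirichlet α θ H : Measure (ProbabilityMeasure I))
        {P | ε ≤ |c * ((P : Measure I).real A - (H : Measure I).real A)|} ≤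
      ENNReal.ofReal (c ^ 2 * ((1 - α) / (1 + θ))) / ENNReal.ofReal (ε ^ 2) := by
  have hmA := measurable_measureReal hA
  refine (measure_le_abs_le _ (by fun_prop) hε).trans (ENNReal.div_le_div_right ?_ _)
  simp_rw [mul_pow, ENNReal.ofReal_mul (sq_nonneg c)]
  rw [lintegral_const_mul _ (by fun_prop)]
  exact mul_le_mul_right (lintegral_poissonDirichlet_sub_sq_le hα₀ hα₁ hθ H hA) _

theorem tendsto_posterior_measure {α θ : ℝ} (hα₀ : 0 ≤ α) (hα₁ : α < 1) (hθ : -α < θ)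
    (H : ProbabilityMeasure I) {x : ℕ → I} (hx : Function.Injective x) {A : Set I}
    (hA : MeasurableSet A) {p : ℝ} (hp : Tendsto
      (fun n : ℕ => (∑ i ∈ Finset.range n, (A.indicator 1 (x i) : ℝ)) / n) atTop (𝓝 p))
    {ε : ℝ} (hε : 0 < ε) :
    Tendsto (fun n : ℕ => (posterior α θ H fun i : Fin n => x i : Measure (ProbabilityMeasure I))
      {P | ε ≤ |(P : Measure I).real A - (α * (H : Measure I).real A + (1 - α) * p)|})
      atTop (𝓝 0) := by
  have hδ : 0 < ε / 4 := by linarith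
  -- Three quarters of `ε` go to the three random terms, the last one to replacing the empirical
  -- mass `q` by its limit `p`.
  set δ := ε / 4
  set C : ℝ := Var[id; (gammaLaw (1 - α) : Measure ℝ)] *
        (4 / (δ * ∫ x, x ∂(gammaLaw (1 - α) : Measure ℝ)) ^ 2 +
          4 / (∫ x, x ∂(gammaLaw (1 - α) : Measure ℝ)) ^ 2)
  have hn : Tendsto (fun n : ℕ => (n : ℝ)) atTop atTop := tendsto_natCast_atTop_atTop
  have t1 : Tendsto (fun n : ℕ => 1 / (θ + (n : ℝ))) atTop (𝓝 0) :=
    tendsto_const_nhds.div_atTop (tendsto_atTop_add_const_left _ θ hn)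
  have t2 : Tendsto (fun n : ℕ => α ^ 2 * ((1 - α) / (1 + (θ + n * α)))) atTop (𝓝 0) := by
    rcases hα₀.eq_or_lt with h0 | h0
    · simp [← h0]
    · have h1 : Tendsto (fun n : ℕ => 1 + (θ + (n : ℝ) * α)) atTop atTop :=
        tendsto_atTop_add_const_left _ _ (tendsto_atTop_add_const_left _ _
          (hn.atTop_mul_const h0))
      simpa using (tendsto_const_nhds.div_atTop h1).const_mul (α ^ 2)
  have t3 : Tendsto (fun n : ℕ => C / (n : ℝ)) atTop (𝓝 0) := tendsto_const_nhds.div_atTop hn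
  have t4 : Tendsto (fun n : ℕ => (θ + n * α) / (θ + n)) atTop (𝓝 α) := by
    -- Uses `(θ + nα)/(θ + n) = α + θ(1 - α)/(θ + n)`.
    have h1 : Tendsto (fun n : ℕ => α + θ * (1 - α) * (1 / (θ + (n : ℝ)))) atTop (𝓝 α) := by
      simpa using (t1.const_mul (θ * (1 - α))).const_add α
    refine h1.congr' ?_
    filter_upwards [hn.eventually_gt_atTop (-θ)] with n h
    have : 0 < θ + (n : ℝ) := by linarith
    field_simp
    ring
  have hlim : Tendsto (fun n : ℕ => ENNReal.ofReal (1 / (θ + (n : ℝ))) / ENNReal.ofReal ((δ / 2) ^ 2)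
      + ENNReal.ofReal (α ^ 2 * ((1 - α) / (1 + (θ + n * α)))) / ENNReal.ofReal (δ ^ 2)
      + ENNReal.ofReal (C / (n : ℝ))) atTop (𝓝 0) := by
    have h1 := ENNReal.Tendsto.div_const (ENNReal.tendsto_ofReal t1)
      (b := ENNReal.ofReal ((δ / 2) ^ 2)) (Or.inr (by simpa using hδ.ne'))
    have h2 := ENNReal.Tendsto.div_const (ENNReal.tendsto_ofReal t2)
      (b := ENNReal.ofReal (δ ^ 2)) (Or.inr (by simpa using hδ.ne'))
    simpa using (h1.add h2).add (ENNReal.tendsto_ofReal t3)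
  refine tendsto_of_tendsto_of_tendsto_of_le_of_le' tendsto_const_nhds hlim
    (Eventually.of_forall fun _ => zero_le) ?_
  filter_upwards [eventually_gt_atTop 0, Metric.tendsto_nhds.1 hp δ hδ,
    Metric.tendsto_nhds.1 t4 (δ / 2) (by positivity)] with n hn0 hpn hmn
  set y : Fin n → I := fun i => x i
  have hy : Function.Injective y := fun i j hij => Fin.ext (hx hij)
  have hn1 : (1 : ℝ) ≤ n := by exact_mod_cast hn0
  -- This needs `n ≥ 1`, since `θ` itself may be negative.
  have ha : 0 < θ + n * α := by nlinarith
  have hb : 0 < (n : ℝ) - n * α := by nlinarith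
  have hne : Nonempty (distinctValues y) := by
    rw [Finset.nonempty_coe_sort, ← Finset.card_pos, card_distinctValues hy]
    exact hn0
  set q : ℝ := (∑ i ∈ Finset.range n, (A.indicator 1 (x i) : ℝ)) / n with hq
  have hqD : q = (∑ z : distinctValues y, (A.indicator 1 (z : I) : ℝ)) /
      Fintype.card (distinctValues y) := by
    rw [sum_distinctValues hy (A.indicator 1), Fintype.card_coe, card_distinctValues hy, hq,
      Finset.sum_range]
  have hab : θ + n * α + (n - n * α) = θ + n := by ring
  rw [Real.dist_eq] at hpn hmn
  have b1 := betaLaw_le_abs_sub_le ha hb hδ (m := α) (by rwa [hab])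
  rw [hab] at b1
  have b2 := poissonDirichlet_le_abs_sub_le hα₀ hα₁ (by linarith : -α < θ + n * α) H hA hδ α
  have b3 := dirichletLaw_const_le (ι := distinctValues y) (sub_pos.2 hα₁) hδ
    (c := fun z => A.indicator 1 (z : I)) fun z => by
      by_cases hz : (z : I) ∈ A <;> simp [hz]
  rw [← hqD, Fintype.card_coe, card_distinctValues hy] at b3
  refine le_trans (measure_mono fun P hP => ?_)
    ((posterior_le_of_injective hα₀ hα₁ H hn0 ha hy hA δ q).trans
      (add_le_add (add_le_add b1 b2) b3))
  change ε ≤ _ at hP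
  change 3 * δ ≤ _
  have h1 : |(α * (H : Measure I).real A + (1 - α) * q) -
      (α * (H : Measure I).real A + (1 - α) * p)| ≤ δ := by
    rw [add_sub_add_left_eq_sub, ← mul_sub, abs_mul, abs_of_pos (sub_pos.2 hα₁)]
    exact (mul_le_of_le_one_left (abs_nonneg _) (by linarith)).trans hpn.le
  have h2 := abs_sub_le ((P : Measure I).real A) (α * (H : Measure I).real A + (1 - α) * q)
    (α * (H : Measure I).real A + (1 - α) * p)
  have : ε = 4 * δ := by simp only [δ]; ring
  linarith

theorem mixture_real {α : ℝ} (h₀ : 0 ≤ α) (h₁ : α ≤ 1) (H P : ProbabilityMeasure I) (A : Set I) :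
    (mixture α h₀ h₁ H P : Measure I).real A =
      α * (H : Measure I).real A + (1 - α) * (P : Measure I).real A := by
  have h : (mixture α h₀ h₁ H P : Measure I) =
    ENNReal.ofReal α • (H : Measure I) + ENNReal.ofReal (1 - α) • (P : Measure I) := rfl
  rw [h, measureReal_add_apply (ENNReal.mul_ne_top ENNReal.ofReal_ne_top (measure_ne_top _ _))
    (ENNReal.mul_ne_top ENNReal.ofReal_ne_top (measure_ne_top _ _)), measureReal_ennreal_smul_apply, measureReal_ennreal_smul_apply,
    ENNReal.toReal_ofReal h₀, ENNReal.toReal_ofReal (sub_nonneg.2 h₁)]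

theorem mixture_eq_right_iff {α : ℝ} (h₀ : 0 ≤ α) (h₁ : α ≤ 1) (H P : ProbabilityMeasure I) :
    mixture α h₀ h₁ H P = P ↔ α = 0 ∨ H = P := by
  have key : mixture α h₀ h₁ H P = P ↔ ∀ A : Set I, MeasurableSet A →
      α * ((H : Measure I).real A - (P : Measure I).real A) = 0 := by
    constructor
    · intro h A _
      have := mixture_real h₀ h₁ H P A
      rw [h] at this
      linarith
    · intro h
      refine Subtype.ext (Measure.ext fun A hA => (measureReal_eq_measureReal_iff
        (measure_ne_top (mixture α h₀ h₁ H P : Measure I) A)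
        (measure_ne_top (P : Measure I) A)).1 ?_)
      have h1 := mixture_real h₀ h₁ H P A
      linarith [h A hA]
  rw [key]
  constructor
  · intro h
    refine or_iff_not_imp_left.2 fun hα => Subtype.ext (Measure.ext fun A hA =>
      (measureReal_eq_measureReal_iff (measure_ne_top (H : Measure I) A)
        (measure_ne_top (P : Measure I) A)).1 ?_)
    exact sub_eq_zero.1 ((mul_eq_zero.1 (h A hA)).resolve_left hα)
  · rintro (h | h) A _ <;> simp [h]

end Limits

end PoissonDirichlet

/-! ### The limit of the posterior and the consistency criterion -/

theorem proposition2p1 {I : Type*} [TopologicalSpace I] [PolishSpace I] [MeasurableSpace I]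
    [BorelSpace I] (α θ : ℝ) (hα₀ : 0 ≤ α) (hα₁ : α < 1) (hθ : -α < θ)
    (H P₀ : ProbabilityMeasure I) (hH : NullSingletonClass (H : Measure I))
    (hP₀ : NullSingletonClass (P₀ : Measure I)) :
    (∀ᵐ x ∂(Measure.infinitePi fun _ : ℕ => (P₀ : Measure I)),
      PoissonDirichlet.PosteriorTendsto α θ H x
        (PoissonDirichlet.mixture α hα₀ hα₁.le H P₀)) ∧
    (PoissonDirichlet.PosteriorConsistentAt α θ H P₀ ↔ α = 0 ∨ H = P₀) := by
  have main : ∀ᵐ x ∂(Measure.infinitePi fun _ : ℕ => (P₀ : Measure I)),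
      PoissonDirichlet.PosteriorTendsto α θ H x
        (PoissonDirichlet.mixture α hα₀ hα₁.le H P₀) := by
    have h1 := PoissonDirichlet.ae_injective_infinitePi (P₀ : Measure I)
    have h2 : ∀ᵐ x ∂(Measure.infinitePi fun _ : ℕ => (P₀ : Measure I)),
        ∀ A ∈ PoissonDirichlet.basicUnions I, Tendsto
          (fun n : ℕ => (∑ i ∈ Finset.range n, (A.indicator 1 (x i) : ℝ)) / n) atTop
          (𝓝 ((P₀ : Measure I).real A)) :=
      (ae_ball_iff PoissonDirichlet.countable_basicUnions).2 fun A hA =>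
        PoissonDirichlet.ae_tendsto_empirical _
          (PoissonDirichlet.isOpen_of_mem_basicUnions hA).measurableSet
    filter_upwards [h1, h2] with x hx hxA
    refine PoissonDirichlet.tendsto_diracProba_of_forall_basicUnions fun A hA ε hε => ?_
    rw [PoissonDirichlet.mixture_real]
    exact PoissonDirichlet.tendsto_posterior_measure hα₀ hα₁ hθ H hx
      (PoissonDirichlet.isOpen_of_mem_basicUnions hA).measurableSet (hxA A hA) hε
  refine ⟨main, ?_⟩
  rw [← PoissonDirichlet.mixture_eq_right_iff hα₀ hα₁.le]
  constructor
  · intro h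
    -- A single data sequence with both limits suffices: the limits do not depend on the data, and a
    -- point mass determines its point.
    obtain ⟨x, hx, hx'⟩ := (main.and h).exists
    exact injective_diracProba (tendsto_nhds_unique hx hx')
  · intro h
    rw [h] at main
    exact main
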